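/- Let $U\subseteq\mathbb R^2$ be open and let $f:U\to\mathbb R$ be a $C^2$ solution on $U$ of \[ 2(x-2f_y)(y+2f_x)(f_{yy}-f_{xx})+(1-2f_{xy})(y+2f_x)^2+(x-2f_y)^2(1+2f_{xy})=0 . \] Call a point of $U$ regular if $x-2f_y$ and $y+2f_x$ do not both vanish there, and singular otherwise. At regular points put \[ g=\frac{y+2f_x}{x-2f_y},\qquad h=\frac{x-2f_y}{y+2f_x}, \] with values in $\mathbb R\cup\{\infty\}$ (the one-point compactification of $\mathbb R$), the value being $\infty$ where the denominator vanishes. Then: 1. The regular points are dense in $U$, and $g$ and $h$ extend (hence uniquely) to continuous maps $U\to\mathbb R\cup\{\infty\}$, again denoted by $g$ and $h$. 2. $U$ is foliated by straight lines: there is a (topological) foliation of $U$, with exactly one leaf through each point, each leaf of which is a connected component of $\ell\cap U$ for some straight line $\ell$. Both $g$ and $h$ are constant (with a finite value, or identically $\infty$) along each leaf. 3. For every $(a,b)\in U$, the leaf through $(a,b)$ is the connected component containing $(a,b)$ of the intersection of $U$ with the line \[ x=-g(a,b)(y-b)+a , \] to be read as $y=b$ if $g(a,b)=\infty$. It is also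 the connected component containing $(a,b)$ of the intersection of $U$ with the line \[ y=-h(a,b)(x-a)+b , \] to be read as $x=a$ if $h(a,b)=\infty$. In particular the first formula, with $g(a,b)$ finite, applies at every point where $a-2f_y(a,b)\neq0$, and the second, with $h(a,b)$ finite, at every point where $b+2f_x(a,b)\ne 0$. -/

import Mathlib

open scoped OnePoint

noncomputable section

namespace ZeroCOT

/-- The partial derivative `f_x` of a function on the `xy`-plane. -/
def dx (f : ℝ × ℝ → ℝ) (p : ℝ × ℝ) : ℝ := fderiv ℝ f p (1, 0)

/-- The partial derivative `f_y` of a function on the `xy`-plane. -/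
def dy (f : ℝ × ℝ → ℝ) (p : ℝ × ℝ) : ℝ := fderiv ℝ f p (0, 1)

/-- The function `x - 2 f_y`. -/
def P (f : ℝ × ℝ → ℝ) (p : ℝ × ℝ) : ℝ := p.1 - 2 * dy f p

/-- The function `y + 2 f_x`. -/
def Q (f : ℝ × ℝ → ℝ) (p : ℝ × ℝ) : ℝ := p.2 + 2 * dx f p

/-- `f` is a `C²` solution on `U` of the equation of graphs with vanishing curvature of
transversality in the Heisenberg group:
`2 (x - 2 f_y) (y + 2 f_x) (f_yy - f_xx) + (1 - 2 f_xy) (y + 2 f_x)² + (x - 2 f_y)² (1 + 2 f_xy) = 0`.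
-/
def IsSolution (f : ℝ × ℝ → ℝ) (U : Set (ℝ × ℝ)) : Prop :=
  ContDiffOn ℝ 2 f U ∧
    ∀ p ∈ U,
      2 * (p.1 - 2 * dy f p) * (p.2 + 2 * dx f p) * (dy (dy f) p - dx (dx f) p)
        + (1 - 2 * dy (dx f) p) * (p.2 + 2 * dx f p) ^ 2
        + (p.1 - 2 * dy f p) ^ 2 * (1 + 2 * dy (dx f) p) = 0

/-- A point is regular if `x - 2 f_y` and `y + 2 f_x` do not both vanish there; otherwise it is
singular. -/
def IsRegular (f : ℝ × ℝ → ℝ) (p : ℝ × ℝ) : Prop := P f p ≠ 0 ∨ Q f p ≠ 0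

/-- The quotient `a / b` as an element of `ℝ ∪ {∞}`, infinite for `b = 0`
(only used when `a` and `b` are not both `0`). -/
def ratio (a b : ℝ) : OnePoint ℝ := if b = 0 then ∞ else ((a / b : ℝ) : OnePoint ℝ)

/-- `g = (y + 2 f_x) / (x - 2 f_y)` at regular points, with values in `ℝ ∪ {∞}`. -/
def g (f : ℝ × ℝ → ℝ) (p : ℝ × ℝ) : OnePoint ℝ := ratio (Q f p) (P f p)

/-- `h = (x - 2 f_y) / (y + 2 f_x)` at regular points, with values in `ℝ ∪ {∞}`. -/
def h (f : ℝ × ℝ → ℝ) (p : ℝ × ℝ) : OnePoint ℝ := ratio (P f p) (Q f p)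

/-- `G` is a continuous extension to all of `U`, as a map into the circle `ℝ ∪ {∞}`, of the
function `k` given at the regular points of `U`. -/
def IsContinuousExtension (f : ℝ × ℝ → ℝ) (U : Set (ℝ × ℝ)) (k G : ℝ × ℝ → OnePoint ℝ) : Prop :=
  ContinuousOn G U ∧ ∀ p ∈ U, IsRegular f p → G p = k p

/-- A straight line in the plane. -/
def IsLine (l : Set (ℝ × ℝ)) : Prop :=
  ∃ a b c : ℝ, (a ≠ 0 ∨ b ≠ 0) ∧ l = {q | a * q.1 + b * q.2 = c}

/-- `F` (the set of leaves) is a foliation of the open set `U` by straight lines: each leaf is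
a connected component of the part of some straight line in `U`, there is exactly one leaf
through each point of `U`, and each point of `U` has a neighbourhood in `U` with a foliation
chart onto an open rectangle, every vertical fibre of which is contained in a single leaf. -/
structure IsFoliationByLines (U : Set (ℝ × ℝ)) (F : Set (Set (ℝ × ℝ))) : Prop where
  leaf_line : ∀ L ∈ F, ∃ l : Set (ℝ × ℝ), IsLine l ∧
    ∃ p ∈ l ∩ U, L = connectedComponentIn (l ∩ U) p
  exists_unique_leaf : ∀ p ∈ U, ∃! L, L ∈ F ∧ p ∈ L
  chart : ∀ p ∈ U, ∃ e : OpenPartialHomeomorph (ℝ × ℝ) (ℝ × ℝ),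
    p ∈ e.source ∧ e.source ⊆ U ∧
    ∃ s₀ s₁ t₀ t₁ : ℝ, e.target = Set.Ioo s₀ s₁ ×ˢ Set.Ioo t₀ t₁ ∧
      ∀ s ∈ Set.Ioo s₀ s₁, ∃ L ∈ F, e.symm '' ({s} ×ˢ Set.Ioo t₀ t₁) ⊆ L

/-- The line `x = -m (y - b) + a` through `(a, b)`; for `m = ∞` the horizontal line `y = b`. -/
def gLine (m : OnePoint ℝ) (p : ℝ × ℝ) : Set (ℝ × ℝ) :=
  m.elim {q : ℝ × ℝ | q.2 = p.2} (fun r : ℝ => {q : ℝ × ℝ | q.1 = -r * (q.2 - p.2) + p.1})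

/-- The line `y = -m (x - a) + b` through `(a, b)`; for `m = ∞` the vertical line `x = a`. -/
def hLine (m : OnePoint ℝ) (p : ℝ × ℝ) : Set (ℝ × ℝ) :=
  m.elim {q : ℝ × ℝ | q.1 = p.1} (fun r : ℝ => {q : ℝ × ℝ | q.2 = -r * (q.1 - p.1) + p.2})

end ZeroCOT

end

/-! Put V = (X, Y) = (x - 2 f_y, y + 2 f_x). Equality of mixed partials gives div V = 2, and the
equation reads ⟨DV W, W⟩ = 0 for W = (Y, -X), so V changes only parallel to itself along W. At
regular points a unit vector T orthogonal to V is therefore constant to first order along T. For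
unit fields in the plane this says exactly that the form T₁ dx + T₂ dy is closed.

The singular points are handled through the divergence. V cannot vanish on an open set, so regular
points are dense. At a zero of V, the second-order part of the equation forces det DV = 0, so DV has
rank one and trace 2. In an orthonormal frame whose first vector n spans its range, V has components
A, B with ∂A/∂n = 2 and DB = 0 there. The quadratic equation forbids the slopes B/A = ±ε nearby,
except for one value of ε. Along a ray in direction ±n, |A| grows linearly while B is of smaller
order, so a slope that starts above ε would have to cross ε. Hence B/A tends to 0, and the direction
of V extends continuously (`isLimitDirection_of_eq_zero`).

Locally T is then a continuous unit field, closed off the zero set of V. By the divergence condition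
one of X_x, Y_y is nonzero, so the zero set satisfies a Lipschitz bound in one coordinate direction;
this is thin enough for the form to be exact (`exists_potential`). Thus T = ∇u with u a C¹ eikonal
function, and a gradient of norm 1 is constant along the segment it spans (`eikonal_const`). This
needs no second derivatives of u, so it passes through singular points. These segments give the
foliation charts, and connectedness carries constancy along whole leaves. -/

namespace ZeroCOT

open Set Filter Topology Metric

/-! ### Exactness of continuous forms that are closed off a thin set -/

section Potential

open MeasureTheory intervalIntegral

/-- The circulation of the form `a dx + b dy` around a rectangle, with sign reversed. -/
noncomputable def loop (a b : ℝ × ℝ → ℝ) (x₁ x₂ y₁ y₂ : ℝ) : ℝ :=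
  ((∫ x in x₁..x₂, a (x, y₂)) - ∫ x in x₁..x₂, a (x, y₁)) -
    ((∫ y in y₁..y₂, b (x₂, y)) - ∫ y in y₁..y₂, b (x₁, y))

/-- `a dx + b dy` is differentiable and closed at `q`. -/
def ClosedAt (a b : ℝ × ℝ → ℝ) (q : ℝ × ℝ) : Prop :=
  ∃ a' b' : ℝ × ℝ →L[ℝ] ℝ, HasFDerivAt a a' q ∧ HasFDerivAt b b' q ∧ a' (0, 1) = b' (1, 0)

/-- Green's theorem: the circulation is the integral of ∂a/∂y - ∂b/∂x, which vanishes on the open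
rectangle. The derivatives need not be continuous. -/
theorem loop_eq_zero {a b : ℝ × ℝ → ℝ} {x₁ x₂ y₁ y₂ : ℝ} (hx : x₁ ≤ x₂) (hy : y₁ ≤ y₂)
    (ha : ContinuousOn a (Icc x₁ x₂ ×ˢ Icc y₁ y₂)) (hb : ContinuousOn b (Icc x₁ x₂ ×ˢ Icc y₁ y₂))
    (hd : ∀ q ∈ Ioo x₁ x₂ ×ˢ Ioo y₁ y₂, ClosedAt a b q) : loop a b x₁ x₂ y₁ y₂ = 0 := by
  classical
  choose! a' b' h using hd
  set R := Ioo x₁ x₂ ×ˢ Ioo y₁ y₂ with hR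
  -- Setting the derivatives to zero off the open rectangle makes the divergence vanish identically,
  -- so its integrability is free.
  have hz : ∀ x, (if x ∈ R then -b' x else 0) (1, 0) + (if x ∈ R then a' x else 0) (0, 1) = 0 := by
    intro x
    by_cases hxR : x ∈ R
    · simp [hxR, (h x hxR).2.2]
    · simp [hxR]
  have key := integral2_divergence_prod_of_hasFDerivAt_off_countable (-b) a
    (fun x => if x ∈ R then -b' x else 0) (fun x => if x ∈ R then a' x else 0) x₁ y₁ x₂ y₂ ∅
    countable_empty (by simpa [uIcc_of_le hx, uIcc_of_le hy] using hb.neg)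
    (by simpa [uIcc_of_le hx, uIcc_of_le hy] using ha)
    (by
      intro x hxm
      have hxR : x ∈ R := by simpa [hx, hy, hR] using hxm
      simpa only [if_pos hxR] using (h x hxR).2.1.neg)
    (by
      intro x hxm
      have hxR : x ∈ R := by simpa [hx, hy, hR] using hxm
      simpa only [if_pos hxR] using (h x hxR).1)
    (by simp only [hz]; exact integrableOn_zero)
  simp only [hz, Pi.neg_apply, intervalIntegral.integral_neg, intervalIntegral.integral_zero] at key
  unfold loop
  linarith

theorem continuousOn_row {a : ℝ × ℝ → ℝ} {s t : Set ℝ} (ha : ContinuousOn a (s ×ˢ t)) {y : ℝ}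
    (hy : y ∈ t) : ContinuousOn (fun x => a (x, y)) s :=
  ha.comp (by fun_prop) fun _ hx => ⟨hx, hy⟩

theorem continuousOn_col {a : ℝ × ℝ → ℝ} {s t : Set ℝ} (ha : ContinuousOn a (s ×ˢ t)) {x : ℝ}
    (hx : x ∈ s) : ContinuousOn (fun y => a (x, y)) t :=
  ha.comp (by fun_prop) fun _ hy => ⟨hx, hy⟩

theorem loop_add_x {a b : ℝ × ℝ → ℝ} {s t : Set ℝ} [s.OrdConnected] (ha : ContinuousOn a (s ×ˢ t))
    {x₁ x₂ x₃ y₁ y₂ : ℝ} (h₁ : x₁ ∈ s) (h₂ : x₂ ∈ s) (h₃ : x₃ ∈ s) (k₁ : y₁ ∈ t) (k₂ : y₂ ∈ t) :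
    loop a b x₁ x₂ y₁ y₂ + loop a b x₂ x₃ y₁ y₂ = loop a b x₁ x₃ y₁ y₂ := by
  have I : ∀ {u v y : ℝ}, u ∈ s → v ∈ s → y ∈ t →
      IntervalIntegrable (fun x => a (x, y)) volume u v := fun hu hv hy =>
    ((continuousOn_row ha hy).mono (OrdConnected.uIcc_subset ‹_› hu hv)).intervalIntegrable
  have e₁ := integral_add_adjacent_intervals (I h₁ h₂ k₁) (I h₂ h₃ k₁)
  have e₂ := integral_add_adjacent_intervals (I h₁ h₂ k₂) (I h₂ h₃ k₂)
  unfold loop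
  linarith

theorem loop_add_y {a b : ℝ × ℝ → ℝ} {s t : Set ℝ} [t.OrdConnected] (hb : ContinuousOn b (s ×ˢ t))
    {x₁ x₂ y₁ y₂ y₃ : ℝ} (h₁ : x₁ ∈ s) (h₂ : x₂ ∈ s) (k₁ : y₁ ∈ t) (k₂ : y₂ ∈ t) (k₃ : y₃ ∈ t) :
    loop a b x₁ x₂ y₁ y₂ + loop a b x₁ x₂ y₂ y₃ = loop a b x₁ x₂ y₁ y₃ := by
  have I : ∀ {u v x : ℝ}, u ∈ t → v ∈ t → x ∈ s →
      IntervalIntegrable (fun y => b (x, y)) volume u v := fun hu hv hx =>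
    ((continuousOn_col hb hx).mono (OrdConnected.uIcc_subset ‹_› hu hv)).intervalIntegrable
  have e₁ := integral_add_adjacent_intervals (I k₁ k₂ h₁) (I k₂ k₃ h₁)
  have e₂ := integral_add_adjacent_intervals (I k₁ k₂ h₂) (I k₂ k₃ h₂)
  unfold loop
  linarith

theorem abs_integral_sub_le {f g : ℝ → ℝ} {u v ε : ℝ} (huv : u ≤ v)
    (hf : ContinuousOn f (Icc u v)) (hg : ContinuousOn g (Icc u v))
    (h : ∀ x ∈ Icc u v, |f x - g x| ≤ ε) :
    |(∫ x in u..v, f x) - ∫ x in u..v, g x| ≤ ε * (v - u) := by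
  rw [← uIcc_of_le huv] at hf hg
  rw [← intervalIntegral.integral_sub hf.intervalIntegrable hg.intervalIntegrable]
  have := intervalIntegral.norm_integral_le_of_norm_le_const (a := u) (b := v) (C := ε)
    (f := fun x => f x - g x) fun x hx => by
      rw [uIoc_of_le huv] at hx
      simpa using h x ⟨hx.1.le, hx.2⟩
  rwa [abs_of_nonneg (sub_nonneg.2 huv), Real.norm_eq_abs] at this

theorem abs_loop_le {a b : ℝ × ℝ → ℝ} {x₁ x₂ y₁ y₂ ε : ℝ} (hx : x₁ ≤ x₂) (hy : y₁ ≤ y₂)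
    (ha : ContinuousOn a (Icc x₁ x₂ ×ˢ Icc y₁ y₂)) (hb : ContinuousOn b (Icc x₁ x₂ ×ˢ Icc y₁ y₂))
    (hεa : ∀ x ∈ Icc x₁ x₂, |a (x, y₂) - a (x, y₁)| ≤ ε)
    (hεb : ∀ y ∈ Icc y₁ y₂, |b (x₂, y) - b (x₁, y)| ≤ ε) :
    |loop a b x₁ x₂ y₁ y₂| ≤ ε * (x₂ - x₁) + ε * (y₂ - y₁) := by
  unfold loop
  refine (abs_sub _ _).trans (add_le_add ?_ ?_)
  · exact abs_integral_sub_le hx (continuousOn_row ha (right_mem_Icc.2 hy))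
      (continuousOn_row ha (left_mem_Icc.2 hy)) hεa
  · exact abs_integral_sub_le hy (continuousOn_col hb (right_mem_Icc.2 hx))
      (continuousOn_col hb (left_mem_Icc.2 hx)) hεb

/-- Circulation around a low rectangle, when the exceptional set lies in a narrow strip. -/
theorem abs_loop_le_of_strip {a b : ℝ × ℝ → ℝ} {S : Set (ℝ × ℝ)} {K η ε x₁ x₂ y₁ y₂ : ℝ}
    (hK : 0 ≤ K) (hε : 0 ≤ ε) (hx : x₁ ≤ x₂) (hy : y₁ ≤ y₂)
    (ha : ContinuousOn a (Icc x₁ x₂ ×ˢ Icc y₁ y₂)) (hb : ContinuousOn b (Icc x₁ x₂ ×ˢ Icc y₁ y₂))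
    (hS : ∀ q ∈ S ∩ Icc x₁ x₂ ×ˢ Icc y₁ y₂, ∀ q' ∈ S ∩ Icc x₁ x₂ ×ˢ Icc y₁ y₂,
      |q.1 - q'.1| ≤ K * |q.2 - q'.2|)
    (hd : ∀ q ∈ Icc x₁ x₂ ×ˢ Icc y₁ y₂, q ∉ S → ClosedAt a b q)
    (hu : ∀ q ∈ Icc x₁ x₂ ×ˢ Icc y₁ y₂, ∀ q' ∈ Icc x₁ x₂ ×ˢ Icc y₁ y₂, dist q q' < η →
      |a q - a q'| ≤ ε ∧ |b q - b q'| ≤ ε)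
    (hη : y₂ - y₁ < η) (hη' : 2 * K * (y₂ - y₁) < η) :
    |loop a b x₁ x₂ y₁ y₂| ≤ ε * (2 * K + 1) * (y₂ - y₁) := by
  have hh : 0 ≤ y₂ - y₁ := sub_nonneg.2 hy
  by_cases hne : ∃ q ∈ Ioo x₁ x₂ ×ˢ Ioo y₁ y₂, q ∈ S
  swap
  · push Not at hne
    rw [loop_eq_zero hx hy ha hb fun q hq =>
      hd q (prod_mono Ioo_subset_Icc_self Ioo_subset_Icc_self hq) (hne q hq), abs_zero]
    positivity
  obtain ⟨⟨x₀, y₀⟩, ⟨hx₀, hy₀⟩, h₀S⟩ := hne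
  simp only at hx₀ hy₀
  have hfar : ∀ q ∈ Icc x₁ x₂ ×ˢ Icc y₁ y₂, q ∈ S → |q.1 - x₀| ≤ K * (y₂ - y₁) := by
    intro q hq hqS
    refine (hS q ⟨hqS, hq⟩ (x₀, y₀) ⟨h₀S, Ioo_subset_Icc_self hx₀, Ioo_subset_Icc_self hy₀⟩).trans
      (mul_le_mul_of_nonneg_left ?_ hK)
    have h2 := hq.2
    exact abs_le.2 ⟨by linarith [h2.1, hy₀.2], by linarith [h2.2, hy₀.1]⟩
  have hKh : 0 ≤ K * (y₂ - y₁) := by positivity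
  -- All exceptional points lie over `[c₁, c₂]`, of width at most 2K times the height. The outer
  -- rectangles contribute nothing, and the middle one is estimated by uniform continuity.
  set c₁ := max x₁ (x₀ - K * (y₂ - y₁)) with hc₁
  set c₂ := min x₂ (x₀ + K * (y₂ - y₁)) with hc₂
  have h1 : x₁ ≤ c₁ := le_max_left _ _
  have h2 : c₁ ≤ x₀ := max_le hx₀.1.le (by linarith)
  have h3 : x₀ ≤ c₂ := le_min hx₀.2.le (by linarith)
  have h4 : c₂ ≤ x₂ := min_le_left _ _
  have h5 : c₂ - c₁ ≤ 2 * K * (y₂ - y₁) := by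
    linarith [min_le_right x₂ (x₀ + K * (y₂ - y₁)), le_max_right x₁ (x₀ - K * (y₂ - y₁))]
  have sub : ∀ {u v : ℝ}, x₁ ≤ u → v ≤ x₂ → Icc u v ×ˢ Icc y₁ y₂ ⊆ Icc x₁ x₂ ×ˢ Icc y₁ y₂ :=
    fun hu hv => prod_mono (Icc_subset_Icc hu hv) subset_rfl
  have L : loop a b x₁ c₁ y₁ y₂ = 0 := by
    refine loop_eq_zero h1 hy (ha.mono (sub le_rfl (by linarith)))
      (hb.mono (sub le_rfl (by linarith))) fun q hq => ?_
    have hqm : q ∈ Icc x₁ x₂ ×ˢ Icc y₁ y₂ :=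
      sub le_rfl (by linarith) (prod_mono Ioo_subset_Icc_self Ioo_subset_Icc_self hq)
    refine hd q hqm fun hqS => ?_
    have := abs_le.1 (hfar q hqm hqS)
    have h6 := hq.1
    rcases lt_max_iff.1 h6.2 with h | h <;> linarith [h6.1, this.1]
  have R : loop a b c₂ x₂ y₁ y₂ = 0 := by
    refine loop_eq_zero h4 hy (ha.mono (sub (by linarith) le_rfl))
      (hb.mono (sub (by linarith) le_rfl)) fun q hq => ?_
    have hqm : q ∈ Icc x₁ x₂ ×ˢ Icc y₁ y₂ :=
      sub (by linarith) le_rfl (prod_mono Ioo_subset_Icc_self Ioo_subset_Icc_self hq)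
    refine hd q hqm fun hqS => ?_
    have := abs_le.1 (hfar q hqm hqS)
    have h6 := hq.1
    rcases min_lt_iff.1 h6.1 with h | h <;> linarith [h6.2, this.2]
  have M : |loop a b c₁ c₂ y₁ y₂| ≤ ε * (c₂ - c₁) + ε * (y₂ - y₁) := by
    refine abs_loop_le (h2.trans h3) hy (ha.mono (sub h1 h4)) (hb.mono (sub h1 h4)) ?_ ?_
    · intro x hxm
      have hxm' : x ∈ Icc x₁ x₂ := ⟨h1.trans hxm.1, hxm.2.trans h4⟩
      refine (hu _ ⟨hxm', right_mem_Icc.2 hy⟩ _ ⟨hxm', left_mem_Icc.2 hy⟩ ?_).1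
      rw [Prod.dist_eq]
      simpa [Real.dist_eq, abs_of_nonneg hh] using ⟨lt_of_le_of_lt hh hη, hη⟩
    · intro y hym
      refine (hu _ ⟨⟨by simp; linarith, h4⟩, hym⟩ _ ⟨⟨h1, by simp; linarith⟩, hym⟩ ?_).2
      rw [Prod.dist_eq]
      have : 0 ≤ c₂ - c₁ := by linarith
      simpa [Real.dist_eq, abs_of_nonneg this] using ⟨by linarith, lt_of_le_of_lt hh hη⟩
  have e₁ : loop a b x₁ c₁ y₁ y₂ + loop a b c₁ c₂ y₁ y₂ = loop a b x₁ c₂ y₁ y₂ :=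
    loop_add_x ha ⟨le_rfl, hx⟩ ⟨h1, by linarith⟩ ⟨by linarith, h4⟩ ⟨le_rfl, hy⟩ ⟨hy, le_rfl⟩
  have e₂ : loop a b x₁ c₂ y₁ y₂ + loop a b c₂ x₂ y₁ y₂ = loop a b x₁ x₂ y₁ y₂ :=
    loop_add_x ha ⟨le_rfl, hx⟩ ⟨by linarith, h4⟩ ⟨hx, le_rfl⟩ ⟨le_rfl, hy⟩ ⟨hy, le_rfl⟩
  rw [← e₂, ← e₁, L, R, zero_add, add_zero]
  have := mul_le_mul_of_nonneg_left h5 hε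
  linarith [M, this, show ε * (2 * K * (y₂ - y₁)) + ε * (y₂ - y₁) = ε * (2 * K + 1) * (y₂ - y₁) by ring]

/-- As a function of the upper side, the circulation has derivative zero: a slab of height h
contributes o(h), because the exceptional set meets it in a strip of width O(h) on which `a` and `b`
oscillate by o(1). -/
theorem loop_eq_zero_of_thin {a b : ℝ × ℝ → ℝ} {S : Set (ℝ × ℝ)} {K x₁ x₂ y₁ y₂ : ℝ}
    (hK : 0 ≤ K) (hx : x₁ ≤ x₂) (hy : y₁ ≤ y₂)
    (ha : ContinuousOn a (Icc x₁ x₂ ×ˢ Icc y₁ y₂)) (hb : ContinuousOn b (Icc x₁ x₂ ×ˢ Icc y₁ y₂))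
    (hS : ∀ q ∈ S ∩ Icc x₁ x₂ ×ˢ Icc y₁ y₂, ∀ q' ∈ S ∩ Icc x₁ x₂ ×ˢ Icc y₁ y₂,
      |q.1 - q'.1| ≤ K * |q.2 - q'.2|)
    (hd : ∀ q ∈ Icc x₁ x₂ ×ˢ Icc y₁ y₂, q ∉ S → ClosedAt a b q) :
    loop a b x₁ x₂ y₁ y₂ = 0 := by
  set R := Icc x₁ x₂ ×ˢ Icc y₁ y₂ with hR
  have hcomp : IsCompact R := isCompact_Icc.prod isCompact_Icc
  have hua := Metric.uniformContinuousOn_iff.1 (hcomp.uniformContinuousOn_of_continuous ha)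
  have hub := Metric.uniformContinuousOn_iff.1 (hcomp.uniformContinuousOn_of_continuous hb)
  have key : ∀ ε > 0, ∃ d > 0, ∀ u ∈ Icc y₁ y₂, ∀ v ∈ Icc y₁ y₂, u ≤ v → v - u < d →
      |loop a b x₁ x₂ u v| ≤ ε * (v - u) := by
    intro ε hε
    have hε' : 0 < ε / (2 * K + 1) := by positivity
    obtain ⟨η₁, h₁, H₁⟩ := hua _ hε'
    obtain ⟨η₂, h₂, H₂⟩ := hub _ hε'
    -- With this bound both the height and the width 2K · height of the strip stay below the modulus
    -- of uniform continuity.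
    refine ⟨min η₁ η₂ / (2 * K + 1), by positivity, fun u hu v hv huv hlt => ?_⟩
    rw [lt_div_iff₀ (by positivity)] at hlt
    have hnn : 0 ≤ K * (v - u) := mul_nonneg hK (by linarith)
    have sub : Icc x₁ x₂ ×ˢ Icc u v ⊆ R := prod_mono subset_rfl (Icc_subset_Icc hu.1 hv.2)
    have := abs_loop_le_of_strip (S := S) (η := min η₁ η₂) hK hε'.le hx huv (ha.mono sub) (hb.mono sub)
      (fun q hq q' hq' => hS q ⟨hq.1, sub hq.2⟩ q' ⟨hq'.1, sub hq'.2⟩)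
      (fun q hq => hd q (sub hq))
      (fun q hq q' hq' hlt => ⟨(H₁ q (sub hq) q' (sub hq') (hlt.trans_le (min_le_left _ _))).le,
        (H₂ q (sub hq) q' (sub hq') (hlt.trans_le (min_le_right _ _))).le⟩)
      (by linarith) (by linarith)
    rwa [div_mul_cancel₀ _ (by positivity)] at this
  have hadd : ∀ u ∈ Icc y₁ y₂, ∀ v ∈ Icc y₁ y₂, loop a b x₁ x₂ y₁ u + loop a b x₁ x₂ u v =
      loop a b x₁ x₂ y₁ v := fun u hu v hv =>
    loop_add_y hb ⟨le_rfl, hx⟩ ⟨hx, le_rfl⟩ ⟨le_rfl, hy⟩ hu hv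
  have key' : ∀ ε > 0, ∃ d > 0, ∀ u ∈ Icc y₁ y₂, ∀ v ∈ Icc y₁ y₂, |v - u| < d →
      |loop a b x₁ x₂ y₁ v - loop a b x₁ x₂ y₁ u| ≤ ε * |v - u| := by
    intro ε hε
    obtain ⟨d, hd0, hd⟩ := key ε hε
    refine ⟨d, hd0, fun u hu v hv hlt => ?_⟩
    rcases le_total u v with h | h
    · rw [abs_of_nonneg (sub_nonneg.2 h)] at hlt ⊢
      rw [← hadd u hu v hv, add_sub_cancel_left]
      exact hd u hu v hv h hlt
    · rw [abs_sub_comm v u, abs_of_nonneg (sub_nonneg.2 h)] at hlt ⊢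
      rw [abs_sub_comm, ← hadd v hv u hu, add_sub_cancel_left]
      exact hd v hv u hu h hlt
  have hder : ∀ u ∈ Icc y₁ y₂,
      HasDerivWithinAt (fun y => loop a b x₁ x₂ y₁ y) 0 (Icc y₁ y₂) u := by
    intro u hu
    rw [hasDerivWithinAt_iff_isLittleO, Asymptotics.isLittleO_iff]
    intro ε hε
    obtain ⟨d, hd0, hd⟩ := key' ε hε
    filter_upwards [self_mem_nhdsWithin, mem_nhdsWithin_of_mem_nhds (Metric.ball_mem_nhds u hd0)]
      with v hv hvd
    simpa using hd u hu v hv (by simpa [Real.dist_eq] using hvd)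
  have := constant_of_has_deriv_right_zero (f := fun y => loop a b x₁ x₂ y₁ y)
    (fun u hu => (hder u hu).continuousWithinAt)
    (fun u hu => (hder u (Ico_subset_Icc_self hu)).mono_of_mem_nhdsWithin (Icc_mem_nhdsGE_of_mem hu))
    y₂ ⟨hy, le_rfl⟩
  simpa [loop] using this

theorem loop_symm_x (a b : ℝ × ℝ → ℝ) (x₁ x₂ y₁ y₂ : ℝ) :
    loop a b x₂ x₁ y₁ y₂ = -loop a b x₁ x₂ y₁ y₂ := by
  unfold loop
  rw [integral_symm x₁ x₂, integral_symm x₁ x₂]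
  ring

theorem loop_symm_y (a b : ℝ × ℝ → ℝ) (x₁ x₂ y₁ y₂ : ℝ) :
    loop a b x₁ x₂ y₂ y₁ = -loop a b x₁ x₂ y₁ y₂ := by
  unfold loop
  rw [integral_symm y₁ y₂, integral_symm y₁ y₂]
  ring

/-- The differential form `a dx + b dy` at a point. -/
def form (s t : ℝ) : ℝ × ℝ →L[ℝ] ℝ :=
  s • ContinuousLinearMap.fst ℝ ℝ ℝ + t • ContinuousLinearMap.snd ℝ ℝ ℝ

@[simp] theorem form_apply (s t : ℝ) (v : ℝ × ℝ) : form s t v = s * v.1 + t * v.2 := by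
  simp [form]

/-- A continuous form that is closed off a set transverse to the horizontal direction is exact. -/
theorem exists_potential_of_transverse {a b : ℝ × ℝ → ℝ} {S : Set (ℝ × ℝ)} {K δ : ℝ} {p : ℝ × ℝ}
    (hK : 0 ≤ K) (ha : ContinuousOn a (ball p δ)) (hb : ContinuousOn b (ball p δ))
    (hS : ∀ q ∈ S ∩ ball p δ, ∀ q' ∈ S ∩ ball p δ, |q.1 - q'.1| ≤ K * |q.2 - q'.2|)
    (hd : ∀ q ∈ ball p δ, q ∉ S → ClosedAt a b q) :
    ∃ u : ℝ × ℝ → ℝ, ∀ q ∈ ball p δ, HasFDerivAt u (form (a q) (b q)) q := by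
  rcases le_or_gt δ 0 with hδ | hδ
  · exact ⟨0, fun q hq => by simp [ball_eq_empty.2 hδ] at hq⟩
  obtain ⟨p₁, p₂⟩ := p
  rw [← ball_prod_same] at *
  set I := ball p₁ δ
  set J := ball p₂ δ
  have hI : I.OrdConnected := (convex_ball p₁ δ).ordConnected
  have hJ : J.OrdConnected := (convex_ball p₂ δ).ordConnected
  have hp₁ : p₁ ∈ I := mem_ball_self hδ
  have hp₂ : p₂ ∈ J := mem_ball_self hδ
  have hz : ∀ x₁ ∈ I, ∀ x₂ ∈ I, ∀ y₁ ∈ J, ∀ y₂ ∈ J, x₁ ≤ x₂ → y₁ ≤ y₂ →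
      loop a b x₁ x₂ y₁ y₂ = 0 := by
    intro x₁ h₁ x₂ h₂ y₁ k₁ y₂ k₂ hx hy
    have sub : Icc x₁ x₂ ×ˢ Icc y₁ y₂ ⊆ I ×ˢ J := prod_mono (hI.out h₁ h₂) (hJ.out k₁ k₂)
    exact loop_eq_zero_of_thin hK hx hy (ha.mono sub) (hb.mono sub)
      (fun q hq q' hq' => hS q ⟨hq.1, sub hq.2⟩ q' ⟨hq'.1, sub hq'.2⟩) fun q hq => hd q (sub hq)
  have hz' : ∀ x₁ ∈ I, ∀ x₂ ∈ I, ∀ y₁ ∈ J, ∀ y₂ ∈ J, loop a b x₁ x₂ y₁ y₂ = 0 := by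
    intro x₁ h₁ x₂ h₂ y₁ k₁ y₂ k₂
    rcases le_total x₁ x₂ with hx | hx <;> rcases le_total y₁ y₂ with hy | hy
    · exact hz _ h₁ _ h₂ _ k₁ _ k₂ hx hy
    · rw [loop_symm_y, hz _ h₁ _ h₂ _ k₂ _ k₁ hx hy, neg_zero]
    · rw [loop_symm_x, hz _ h₂ _ h₁ _ k₁ _ k₂ hx hy, neg_zero]
    · rw [loop_symm_x, loop_symm_y, hz _ h₂ _ h₁ _ k₂ _ k₁ hx hy, neg_zero, neg_zero]
  have Ia : ∀ {u v y : ℝ}, u ∈ I → v ∈ I → y ∈ J →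
      IntervalIntegrable (fun x => a (x, y)) volume u v := fun hu hv hy =>
    ((continuousOn_row ha hy).mono (hI.uIcc_subset hu hv)).intervalIntegrable
  have Ib : ∀ {u v x : ℝ}, u ∈ J → v ∈ J → x ∈ I →
      IntervalIntegrable (fun y => b (x, y)) volume u v := fun hu hv hx =>
    ((continuousOn_col hb hx).mono (hJ.uIcc_subset hu hv)).intervalIntegrable
  -- Integrate vertically along x = p₁, then horizontally to q.
  refine ⟨fun q => (∫ x in p₁..q.1, a (x, q.2)) + ∫ y in p₂..q.2, b (p₁, y), fun q hq => ?_⟩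
  rw [hasFDerivAt_iff_isLittleO_nhds_zero, Asymptotics.isLittleO_iff]
  intro ε hε
  have hopen : I ×ˢ J ∈ 𝓝 q := (isOpen_ball.prod isOpen_ball).mem_nhds hq
  have hε2 : 0 < ε / 2 := by positivity
  have ca := Metric.continuousAt_iff.1 (ha.continuousAt hopen) _ hε2
  have cb := Metric.continuousAt_iff.1 (hb.continuousAt hopen) _ hε2
  obtain ⟨d₁, hd₁, H₁⟩ := ca
  obtain ⟨d₂, hd₂, H₂⟩ := cb
  obtain ⟨d₃, hd₃, H₃⟩ := Metric.mem_nhds_iff.1 hopen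
  filter_upwards [Metric.ball_mem_nhds (0 : ℝ × ℝ) (lt_min hd₁ (lt_min hd₂ hd₃))] with v hv
  rw [mem_ball_zero_iff, lt_min_iff, lt_min_iff] at hv
  obtain ⟨hv₁, hv₂, hv₃⟩ := hv
  obtain ⟨q₁, q₂⟩ := q
  obtain ⟨v₁, v₂⟩ := v
  have hn₁ : |v₁| ≤ ‖(v₁, v₂)‖ := norm_fst_le (v₁, v₂)
  have hn₂ : |v₂| ≤ ‖(v₁, v₂)‖ := norm_snd_le (v₁, v₂)
  have hqv : (q₁ + v₁, q₂ + v₂) ∈ I ×ˢ J := H₃ (by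
    rw [mem_ball_iff_norm]; simpa using hv₃)
  -- Zero circulation moves the vertical increment from x = p₁ to x = q₁, next to q, where `b` is
  -- nearly constant.
  have hL := hz' p₁ hp₁ q₁ hq.1 q₂ hq.2 (q₂ + v₂) hqv.2
  have e₁ := integral_add_adjacent_intervals (Ia hp₁ hq.1 hqv.2) (Ia hq.1 hqv.1 hqv.2)
  have e₂ := integral_add_adjacent_intervals (Ib hp₂ hq.2 hp₁) (Ib hq.2 hqv.2 hp₁)
  have b₁ : |(∫ x in q₁..(q₁ + v₁), a (x, q₂ + v₂)) - a (q₁, q₂) * v₁| ≤ ε / 2 * |v₁| := by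
    have := intervalIntegral.norm_integral_le_of_norm_le_const (a := q₁) (b := q₁ + v₁) (C := ε / 2)
      (f := fun x => a (x, q₂ + v₂) - a (q₁, q₂)) fun x hx => by
        refine (H₁ (x := (x, q₂ + v₂)) ?_).le
        have hx' : |x - q₁| ≤ |v₁| := by
          have := abs_sub_left_of_mem_uIcc (uIoc_subset_uIcc hx)
          simpa using this
        rw [Prod.dist_eq, Real.dist_eq, Real.dist_eq]
        exact max_lt (by simp only; linarith) (by simp only [add_sub_cancel_left]; linarith)
    rw [intervalIntegral.integral_sub (Ia hq.1 hqv.1 hqv.2) (by simp)] at this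
    simpa [mul_comm] using this
  have b₂ : |(∫ y in q₂..(q₂ + v₂), b (q₁, y)) - b (q₁, q₂) * v₂| ≤ ε / 2 * |v₂| := by
    have := intervalIntegral.norm_integral_le_of_norm_le_const (a := q₂) (b := q₂ + v₂) (C := ε / 2)
      (f := fun y => b (q₁, y) - b (q₁, q₂)) fun y hy => by
        refine (H₂ (x := (q₁, y)) ?_).le
        have hy' : |y - q₂| ≤ |v₂| := by
          have := abs_sub_left_of_mem_uIcc (uIoc_subset_uIcc hy)
          simpa using this
        rw [Prod.dist_eq, Real.dist_eq, Real.dist_eq]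
        exact max_lt (by simpa using hd₂) (by simp only; linarith)
    rw [intervalIntegral.integral_sub (Ib hq.2 hqv.2 hq.1) (by simp)] at this
    simpa [mul_comm] using this
  unfold loop at hL
  simp only [Prod.mk_add_mk, form_apply, Real.norm_eq_abs]
  rw [show (∫ x in p₁..(q₁ + v₁), a (x, q₂ + v₂)) + (∫ y in p₂..(q₂ + v₂), b (p₁, y)) -
      ((∫ x in p₁..q₁, a (x, q₂)) + ∫ y in p₂..q₂, b (p₁, y)) -
      (a (q₁, q₂) * v₁ + b (q₁, q₂) * v₂) =
      ((∫ x in q₁..(q₁ + v₁), a (x, q₂ + v₂)) - a (q₁, q₂) * v₁) +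
      ((∫ y in q₂..(q₂ + v₂), b (q₁, y)) - b (q₁, q₂) * v₂) by linarith]
  refine (abs_add_le _ _).trans ((add_le_add b₁ b₂).trans ?_)
  have m₁ := mul_le_mul_of_nonneg_left hn₁ hε2.le
  have m₂ := mul_le_mul_of_nonneg_left hn₂ hε2.le
  linarith

/-- A continuous form that is closed off a set transverse to one of the coordinate directions is
exact. -/
theorem exists_potential {a b : ℝ × ℝ → ℝ} {S : Set (ℝ × ℝ)} {K δ : ℝ} {p : ℝ × ℝ}
    (hK : 0 ≤ K) (ha : ContinuousOn a (ball p δ)) (hb : ContinuousOn b (ball p δ))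
    (hS : (∀ q ∈ S ∩ ball p δ, ∀ q' ∈ S ∩ ball p δ, |q.1 - q'.1| ≤ K * |q.2 - q'.2|) ∨
      ∀ q ∈ S ∩ ball p δ, ∀ q' ∈ S ∩ ball p δ, |q.2 - q'.2| ≤ K * |q.1 - q'.1|)
    (hd : ∀ q ∈ ball p δ, q ∉ S → ClosedAt a b q) :
    ∃ u : ℝ × ℝ → ℝ, ∀ q ∈ ball p δ, HasFDerivAt u (form (a q) (b q)) q := by
  rcases hS with hS | hS
  · exact exists_potential_of_transverse hK ha hb hS hd
  -- Swapping the coordinates exchanges the two transversality conditions and preserves closedness.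
  let σ : (ℝ × ℝ) ≃L[ℝ] (ℝ × ℝ) := ContinuousLinearEquiv.prodComm ℝ ℝ ℝ
  have hσ : ∀ q : ℝ × ℝ, σ q = (q.2, q.1) := fun q => rfl
  have hball : ∀ q, q ∈ ball (σ p) δ ↔ σ q ∈ ball p δ := by
    intro q
    simp [mem_ball, Prod.dist_eq, hσ, and_comm]
  have hm : MapsTo σ (ball (σ p) δ) (ball p δ) := fun q hq => (hball q).1 hq
  obtain ⟨u, hu⟩ := exists_potential_of_transverse (a := b ∘ σ) (b := a ∘ σ) (S := σ ⁻¹' S)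
    (p := σ p) (δ := δ) hK (hb.comp σ.continuous.continuousOn hm)
    (ha.comp σ.continuous.continuousOn hm)
    (fun q hq q' hq' => hS (σ q) ⟨hq.1, hm hq.2⟩ (σ q') ⟨hq'.1, hm hq'.2⟩)
    (fun q hq hqS => by
      obtain ⟨a', b', h₁, h₂, h₃⟩ := hd (σ q) (hm hq) hqS
      refine ⟨b' ∘L σ, a' ∘L σ, h₂.comp q σ.hasFDerivAt, h₁.comp q σ.hasFDerivAt, ?_⟩
      simp [hσ, h₃])
  refine ⟨u ∘ σ, fun q hq => ?_⟩
  have := (hu (σ q) ((hball _).2 (by simpa [hσ] using hq))).comp q σ.hasFDerivAt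
  refine this.congr_fderiv ?_
  ext <;> simp [hσ]

end Potential

/-! ### Rigidity of C¹ eikonal functions -/

section Eikonal

variable {E : Type*} [NormedAddCommGroup E] [InnerProductSpace ℝ E]

/-- Moving along the gradient of an eikonal function, some point at distance `r` has value
larger by `r`. -/
theorem exists_mem_sphere_eikonal [ProperSpace E] {u : E → ℝ} {T : E → E} {p : E} {r : ℝ}
    (hr : 0 ≤ r) (hu : ∀ q ∈ closedBall p r, HasFDerivAt u (innerSL ℝ (T q)) q)
    (hT : ∀ q ∈ closedBall p r, ‖T q‖ = 1) :
    ∃ q ∈ sphere p r, u p + r ≤ u q := by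
  have hcont : ContinuousOn u (closedBall p r) := fun q hq =>
    (hu q hq).continuousAt.continuousWithinAt
  have key : ∀ ε ∈ Ioo (0 : ℝ) 1, ∃ q ∈ sphere p r, u p + (1 - ε) * r ≤ u q := by
    intro ε hε
    -- The maximum of u minus the penalty lies on the sphere: from an interior point, a step t along
    -- T raises u by t - o(t) and the penalty by at most (1 - ε) t.
    obtain ⟨q, hq, hmax⟩ := (isCompact_closedBall p r).exists_isMaxOn
      ⟨p, mem_closedBall_self hr⟩
      (f := fun q => u q - (1 - ε) * dist q p) (by fun_prop)
    have hp := hmax (mem_closedBall_self hr)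
    simp only [mem_ofPred_eq, dist_self, mul_zero, sub_zero] at hp
    rcases (mem_closedBall.1 hq).lt_or_eq with hlt | heq
    · exfalso
      have hder : HasDerivAt (fun t : ℝ => u (q + t • T q)) 1 0 := by
        have h1 : HasDerivAt (fun t : ℝ => q + t • T q) (T q) 0 := by
          simpa using ((hasDerivAt_id (0 : ℝ)).smul_const (T q)).const_add q
        have h2 := (show HasFDerivAt u (innerSL ℝ (T q)) (q + (0 : ℝ) • T q) by
          simpa using hu q hq).comp_hasDerivAt (0 : ℝ) h1
        have h3 : HasDerivAt (u ∘ fun t : ℝ => q + t • T q) 1 0 := by simpa [Function.comp_def, hT q hq] using h2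
        exact h3
      have hlit := (hasDerivAt_iff_isLittleO.1 hder)
      rw [Asymptotics.isLittleO_iff] at hlit
      have h3 := hlit (half_pos hε.1)
      have h4 : ∀ᶠ t : ℝ in 𝓝 0, q + t • T q ∈ closedBall p r := by
        have : Tendsto (fun t : ℝ => q + t • T q) (𝓝 0) (𝓝 q) := by
          have : Continuous (fun t : ℝ => q + t • T q) := by fun_prop
          simpa using this.tendsto 0
        exact this (mem_of_superset (isOpen_ball.mem_nhds hlt) ball_subset_closedBall)
      obtain ⟨t, ⟨h5, h6⟩, ht⟩ := (((h3.and h4).filter_mono nhdsWithin_le_nhds).and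
        (self_mem_nhdsWithin (s := Ioi (0 : ℝ)))).exists
      have ht : 0 < t := ht
      simp only [zero_smul, add_zero, sub_zero, smul_eq_mul, mul_one, Real.norm_eq_abs,
        abs_of_pos ht] at h5
      have h7 := (abs_le.1 h5).1
      have h8 := hmax h6
      simp only [mem_ofPred_eq] at h8
      have h9 : dist (q + t • T q) p ≤ dist q p + t := by
        calc dist (q + t • T q) p ≤ dist (q + t • T q) q + dist q p := dist_triangle _ _ _
          _ = dist q p + t := by simp [norm_smul, hT q hq, abs_of_pos ht, add_comm]
      nlinarith [mul_le_mul_of_nonneg_left h9 (sub_nonneg.2 hε.2.le), mul_pos hε.1 ht]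
    · refine ⟨q, heq, ?_⟩
      rw [heq] at hp
      linarith
  obtain ⟨q₀, hq₀, -⟩ := key (1 / 2) ⟨by norm_num, by norm_num⟩
  obtain ⟨q, hq, hmax⟩ := (isCompact_sphere p r).exists_isMaxOn ⟨q₀, hq₀⟩
    (hcont.mono sphere_subset_closedBall)
  refine ⟨q, hq, le_of_forall_pos_lt_add fun ε hε => ?_⟩
  set η := min (1 / 2) (ε / (2 * (r + 1))) with hη
  have hη0 : 0 < η := by positivity
  obtain ⟨q', hq', h⟩ := key η ⟨hη0, lt_of_le_of_lt (min_le_left _ _) (by norm_num)⟩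
  have h1 := hmax hq'
  simp only [mem_ofPred_eq] at h1
  have h2 : η * (2 * (r + 1)) ≤ ε := by
    rw [← le_div_iff₀ (by positivity)]
    exact min_le_right _ _
  nlinarith

/-- The gradient of a `C¹` eikonal function is constant along the straight line that it spans. -/
theorem eikonal_const_of_nonneg [ProperSpace E] {u : E → ℝ} {T : E → E} {p : E} {r : ℝ}
    (hr : 0 < r) (hu : ∀ q ∈ closedBall p r, HasFDerivAt u (innerSL ℝ (T q)) q)
    (hT : ∀ q ∈ closedBall p r, ‖T q‖ = 1) (hc : ContinuousOn T (closedBall p r)) {s : ℝ}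
    (hs : s ∈ Icc 0 r) : T (p + s • T p) = T p := by
  obtain ⟨q, hq, hle⟩ := exists_mem_sphere_eikonal hr.le hu hT
  have hlip : ∀ x ∈ closedBall p r, ∀ y ∈ closedBall p r, u y - u x ≤ ‖y - x‖ := by
    intro x hx y hy
    have := (convex_closedBall p r).norm_image_sub_le_of_norm_hasFDerivWithin_le (C := 1)
      (fun z hz => (hu z hz).hasFDerivWithinAt) (fun z hz => by simp [hT z hz]) hx hy
    rw [one_mul] at this
    exact (le_abs_self _).trans this
  set e := r⁻¹ • (q - p) with he
  have hqr : ‖q - p‖ = r := mem_sphere_iff_norm.1 hq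
  have hen : ‖e‖ = 1 := by
    rw [he, norm_smul, hqr, norm_inv, Real.norm_of_nonneg hr.le, inv_mul_cancel₀ hr.ne']
  have hre : p + r • e = q := by rw [he, smul_inv_smul₀ hr.ne']; abel
  have hmem : ∀ t ∈ Icc 0 r, p + t • e ∈ closedBall p r := by
    intro t ht
    simp [norm_smul, hen, abs_of_nonneg ht.1, ht.2]
  -- u is 1-Lipschitz and rises by at least r over distance r, so it rises at unit speed all along
  -- the segment.
  have hval : ∀ t ∈ Icc 0 r, u (p + t • e) = u p + t := by
    intro t ht
    have h1 := hlip p (mem_closedBall_self hr.le) _ (hmem t ht)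
    have h2 := hlip _ (hmem t ht) q (sphere_subset_closedBall hq)
    rw [← hre, show p + r • e - (p + t • e) = (r - t) • e by rw [sub_smul]; abel, norm_smul, hen,
      Real.norm_of_nonneg (sub_nonneg.2 ht.2), hre] at h2
    rw [add_sub_cancel_left, norm_smul, hen, Real.norm_of_nonneg ht.1] at h1
    linarith
  have hopen : ∀ t ∈ Ioo 0 r, T (p + t • e) = e := by
    intro t ht
    have h1 : HasDerivAt (fun t : ℝ => p + t • e) e t := by
      simpa using ((hasDerivAt_id t).smul_const e).const_add p
    have hm := hmem t (Ioo_subset_Icc_self ht)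
    have h2 := (hu _ hm).comp_hasDerivAt t h1
    have h3 : HasDerivAt (fun t : ℝ => u p + t) 1 t := (hasDerivAt_id t).const_add _
    have h4 : u ∘ (fun t : ℝ => p + t • e) =ᶠ[𝓝 t] fun t => u p + t := by
      filter_upwards [Ioo_mem_nhds ht.1 ht.2] with z hz using hval z (Ioo_subset_Icc_self hz)
    -- The derivative gives ⟨T, e⟩ = 1 for two unit vectors: equality in Cauchy–Schwarz, so T = e.
    have h5 := h2.unique (h3.congr_of_eventuallyEq h4)
    rw [innerSL_apply_apply] at h5
    exact (inner_eq_one_iff_of_norm_eq_one (hT _ hm) hen).1 h5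
  have hclosed : ∀ t ∈ Icc 0 r, T (p + t • e) = e := by
    have hc' : ContinuousOn (fun t : ℝ => T (p + t • e)) (Icc 0 r) :=
      hc.comp (by fun_prop) hmem
    exact EqOn.of_subset_closure (g := fun _ => e) hopen hc' continuousOn_const
      Ioo_subset_Icc_self (closure_Ioo hr.ne).ge
  have hp : T p = e := by simpa using hclosed 0 ⟨le_rfl, hr.le⟩
  rw [hp]
  exact hclosed s hs

/-- Negative parameters follow since -u is eikonal with gradient -T. -/
theorem eikonal_const [ProperSpace E] {u : E → ℝ} {T : E → E} {p : E} {r : ℝ}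
    (hr : 0 < r) (hu : ∀ q ∈ closedBall p r, HasFDerivAt u (innerSL ℝ (T q)) q)
    (hT : ∀ q ∈ closedBall p r, ‖T q‖ = 1) (hc : ContinuousOn T (closedBall p r)) {s : ℝ}
    (hs : |s| ≤ r) : T (p + s • T p) = T p := by
  rcases le_total 0 s with h | h
  · exact eikonal_const_of_nonneg hr hu hT hc ⟨h, (le_abs_self s).trans hs⟩
  · have := eikonal_const_of_nonneg (u := -u) (T := -T) (s := -s) hr
      (fun q hq => by simpa using (hu q hq).neg) (fun q hq => by simpa using hT q hq) hc.neg
      ⟨by linarith, (neg_le_abs s).trans hs⟩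
    simpa using this

/-- The planar version in coordinates, for the sup metric ball. -/
theorem eikonal_const_plane {u : ℝ × ℝ → ℝ} {T : ℝ × ℝ → ℝ × ℝ} {p : ℝ × ℝ} {δ : ℝ}
    (hu : ∀ q ∈ ball p δ, HasFDerivAt u (form (T q).1 (T q).2) q)
    (hT : ∀ q ∈ ball p δ, (T q).1 ^ 2 + (T q).2 ^ 2 = 1) (hc : ContinuousOn T (ball p δ)) :
    ∀ q ∈ ball p (δ / 4), ∀ s : ℝ, |s| ≤ δ / 2 → T (q + s • T q) = T q := by
  intro q hq s hs
  -- The product carries the sup norm, so the Euclidean argument is run in ℂ.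
  let σ : ℂ ≃L[ℝ] ℝ × ℝ := Complex.equivRealProdCLM
  have hσ : ∀ z : ℂ, σ z = (z.re, z.im) := fun z => rfl
  have hδ : 0 < δ := by linarith [pos_of_mem_ball hq]
  have hsub : ∀ z ∈ closedBall (σ.symm q) (δ / 2), σ z ∈ ball p δ := by
    intro z hz
    have h1 : dist (σ z) q ≤ δ / 2 := by
      have h2 : ‖z - σ.symm q‖ ≤ δ / 2 := mem_closedBall_iff_norm.1 hz
      have h3 := Complex.abs_re_le_norm (z - σ.symm q)
      have h4 := Complex.abs_im_le_norm (z - σ.symm q)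
      have h5 : σ (σ.symm q) = q := σ.apply_symm_apply q
      rw [Prod.dist_eq, Real.dist_eq, Real.dist_eq]
      rw [hσ] at h5
      rw [← h5, hσ]
      simp only [Complex.sub_re, Complex.sub_im] at h3 h4
      exact max_le (h3.trans h2) (h4.trans h2)
    have := mem_ball.1 hq
    rw [mem_ball]
    linarith [dist_triangle (σ z) q p]
  have hm : MapsTo σ (closedBall (σ.symm q) (δ / 2)) (ball p δ) := hsub
  have key := eikonal_const (u := u ∘ σ) (T := fun z => σ.symm (T (σ z))) (p := σ.symm q)
    (half_pos hδ) (fun z hz => by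
      have h1 := (hu (σ z) (hsub z hz)).comp z σ.hasFDerivAt
      refine h1.congr_fderiv (ContinuousLinearMap.ext fun w => ?_)
      have h2 : σ (σ.symm (T (σ z))) = T (σ z) := σ.apply_symm_apply _
      rw [hσ, Prod.ext_iff] at h2
      simp only [hσ z] at h2
      simp only [innerSL_apply_apply, Complex.inner, ContinuousLinearMap.comp_apply,
        ContinuousLinearEquiv.coe_coe, hσ, form_apply, Complex.mul_re, Complex.conj_re,
        Complex.conj_im, h2.1, h2.2]
      ring)
    (fun z hz => by
      have h2 : σ (σ.symm (T (σ z))) = T (σ z) := σ.apply_symm_apply _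
      rw [hσ, Prod.ext_iff] at h2
      simp only at h2
      have h3 := hT (σ z) (hsub z hz)
      rw [← h2.1, ← h2.2] at h3
      rw [Complex.norm_def, Complex.normSq_apply, ← sq, ← sq, h3, Real.sqrt_one])
    (σ.symm.continuous.comp_continuousOn (hc.comp σ.continuous.continuousOn hm)) hs
  have h6 := σ.symm.injective key
  rwa [map_add, map_smul, σ.apply_symm_apply, σ.apply_symm_apply] at h6

end Eikonal

/-! ### Limit directions at zeros of the field -/

/-- Near a common zero of `A` and `B` at which `A` has derivative `2` along `n` and `B` is
stationary, the quadratic equation forces `B / A` to be small. -/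
theorem eventually_abs_le_of_ne {A B : ℝ × ℝ → ℝ} {A' B' : ℝ × ℝ → ℝ × ℝ →L[ℝ] ℝ} {p n k : ℝ × ℝ}
    (hn : ‖n‖ ≤ 1) (hA : ∀ᶠ q in 𝓝 p, HasFDerivAt A (A' q) q)
    (hB : ∀ᶠ q in 𝓝 p, HasFDerivAt B (B' q) q) (hA' : ContinuousAt A' p) (hB' : ContinuousAt B' p)
    (hBp : B p = 0) (hB'p : B' p = 0) (hA'p : A' p n = 2)
    (heq : ∀ᶠ q in 𝓝 p, A' q n * B q ^ 2 - A q * B q * (A' q k + B' q n) + B' q k * A q ^ 2 = 0)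
    {ε : ℝ} (hε : 0 < ε) (hne : 2 * ε ≠ |A' p k|) :
    ∀ᶠ q in 𝓝 p, A q ≠ 0 ∨ B q ≠ 0 → A q ≠ 0 ∧ |B q| ≤ ε * |A q| := by
  have cAn : ContinuousAt (fun q => A' q n) p := hA'.clm_apply continuousAt_const
  have cAk : ContinuousAt (fun q => A' q k) p := hA'.clm_apply continuousAt_const
  have cBn : ContinuousAt (fun q => B' q n) p := hB'.clm_apply continuousAt_const
  have cBk : ContinuousAt (fun q => B' q k) p := hB'.clm_apply continuousAt_const
  have h1 : ∀ᶠ q in 𝓝 p, 1 < A' q n := cAn.eventually_const_lt (by simp only [hA'p]; norm_num)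
  have h2 : ∀ᶠ q in 𝓝 p, A' q n * ε ^ 2 - ε * (A' q k + B' q n) + B' q k ≠ 0 := by
    -- This is the quadratic equation at B = εA, divided by A². At p its value is ε(2ε - A'k),
    -- nonzero by `hne`; the slope -ε is treated in the same way.
    have : ContinuousAt (fun q => A' q n * ε ^ 2 - ε * (A' q k + B' q n) + B' q k) p := by fun_prop
    refine this.eventually_ne ?_
    simp only [hA'p, hB'p, _root_.zero_apply]
    intro h
    have h' : ε * (2 * ε - A' p k) = 0 := by linarith
    rcases mul_eq_zero.1 h' with h' | h'
    · exact hε.ne' h'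
    · exact hne (by rw [abs_of_nonneg] <;> linarith)
  have h3 : ∀ᶠ q in 𝓝 p, A' q n * ε ^ 2 + ε * (A' q k + B' q n) + B' q k ≠ 0 := by
    have : ContinuousAt (fun q => A' q n * ε ^ 2 + ε * (A' q k + B' q n) + B' q k) p := by fun_prop
    refine this.eventually_ne ?_
    simp only [hA'p, hB'p, _root_.zero_apply]
    intro h
    have h' : ε * (2 * ε + A' p k) = 0 := by linarith
    rcases mul_eq_zero.1 h' with h' | h'
    · exact hε.ne' h'
    · exact hne (by rw [abs_of_nonpos] <;> linarith)
  have h4 : ∀ᶠ q in 𝓝 p, |B q| ≤ ε / 4 * ‖q - p‖ := by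
    have := hasFDerivAt_iff_isLittleO.1 hB.self_of_nhds
    rw [Asymptotics.isLittleO_iff] at this
    filter_upwards [this (show 0 < ε / 4 by positivity)] with q hq
    simpa [hBp, hB'p] using hq
  obtain ⟨ρ, hρ, H⟩ := Metric.eventually_nhds_iff_ball.1
    (hA.and (hB.and (heq.and (h1.and (h2.and (h3.and h4))))))
  have hball : ball p (ρ / 3) ∈ 𝓝 p := ball_mem_nhds p (by positivity)
  filter_upwards [hball] with q hq hreg
  have hqρ : q ∈ ball p ρ := ball_subset_ball (by linarith) hq
  have hA0 : A q ≠ 0 := by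
    obtain ⟨-, -, e, a1, -⟩ := H q hqρ
    intro h0
    have : A' q n * B q ^ 2 = 0 := by simpa [h0] using e
    rcases mul_eq_zero.1 this with h | h
    · linarith
    · exact hreg.elim (fun h' => h' h0) fun h' => h' (by simpa using h)
  refine ⟨hA0, ?_⟩
  obtain ⟨σ, hσ, hσA⟩ : ∃ σ : ℝ, |σ| = 1 ∧ σ * A q = |A q| := by
    rcases lt_or_gt_of_ne hA0 with h | h
    · exact ⟨-1, by simp, by simp [abs_of_neg h]⟩
    · exact ⟨1, by simp, by simp [abs_of_pos h]⟩
  have hσ2 : σ * σ = 1 := by rw [← abs_mul_abs_self, hσ, one_mul]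
  set τ := ρ / 3 with hτ
  have hτ0 : 0 < τ := by positivity
  -- σ is the sign of A q, so σA grows at rate at least 1 along this ray. Starting within ρ/3 of p
  -- and running for time ρ/3 keeps it in the ball of radius ρ.
  set z : ℝ → ℝ × ℝ := fun t => q + t • (σ • n) with hz
  have hnz : ∀ t ∈ Icc 0 τ, ‖z t - p‖ < 2 * τ := by
    intro t ht
    have e : z t - p = (q - p) + t • (σ • n) := by simp only [hz]; abel
    have h5 : ‖t • (σ • n)‖ ≤ τ := by
      rw [norm_smul, norm_smul, Real.norm_eq_abs, Real.norm_eq_abs, hσ, one_mul, abs_of_nonneg ht.1]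
      nlinarith [ht.1, ht.2, norm_nonneg n]
    rw [e]
    have h6 := mem_ball_iff_norm.1 hq
    linarith [norm_add_le (q - p) (t • (σ • n))]
  have hzm : ∀ t ∈ Icc 0 τ, z t ∈ ball p ρ := fun t ht => by
    rw [mem_ball_iff_norm]; linarith [hnz t ht]
  have hzd : ∀ t, HasDerivAt z (σ • n) t := fun t => by
    have := ((hasDerivAt_id t).smul_const (σ • n)).const_add q
    rw [one_smul] at this
    exact this
  have hzc : Continuous z := by fun_prop
  have hφ : ∀ t ∈ Icc 0 τ, HasDerivAt (fun t => σ * A (z t)) (A' (z t) n) t := by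
    intro t ht
    have := ((H _ (hzm t ht)).1.comp_hasDerivAt t (hzd t)).const_mul σ
    simpa [← mul_assoc, hσ2] using this
  have hgrow : ∀ t ∈ Icc 0 τ, |A q| + t ≤ σ * A (z t) := by
    intro t ht
    have := (convex_Icc 0 τ).mul_sub_le_image_sub_of_le_deriv (f := fun t => σ * A (z t)) (C := 1)
      (fun t ht => (hφ t ht).continuousAt.continuousWithinAt)
      (fun t ht => (hφ t (interior_subset ht)).differentiableAt.differentiableWithinAt)
      (fun t ht => by
        rw [(hφ t (interior_subset ht)).deriv]
        exact (H _ (hzm t (interior_subset ht))).2.2.2.1.le)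
      0 ⟨le_rfl, hτ0.le⟩ t ht ht.1
    simp only [hz, zero_smul, add_zero, hσA] at this ⊢
    linarith
  have hψc : ContinuousOn (fun t => |B (z t)| - ε * (σ * A (z t))) (Icc 0 τ) := by
    intro t ht
    have c1 : ContinuousAt B (z t) := (H _ (hzm t ht)).2.1.continuousAt
    have c2 : ContinuousAt (fun t => B (z t)) t := c1.comp hzc.continuousAt
    exact (c2.abs.sub ((hφ t ht).continuousAt.const_mul ε)).continuousWithinAt
  have hψ0 : ∀ t ∈ Icc 0 τ, |B (z t)| - ε * (σ * A (z t)) ≠ 0 := by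
    intro t ht h0
    obtain ⟨-, -, e, -, e2, e3, -⟩ := H _ (hzm t ht)
    have hpos : 0 < σ * A (z t) := by
      have := hgrow t ht
      linarith [abs_pos.2 hA0, ht.1]
    have hAz : A (z t) ≠ 0 := fun h => by simp [h] at hpos
    have hsq : B (z t) ^ 2 = ε ^ 2 * A (z t) ^ 2 := by
      rw [← sq_abs, sub_eq_zero.1 h0]
      linear_combination ε ^ 2 * A (z t) ^ 2 * hσ2
    have hor : B (z t) = ε * A (z t) ∨ B (z t) = -(ε * A (z t)) :=
      sq_eq_sq_iff_eq_or_eq_neg.1 (by rw [hsq]; ring)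
    rcases hor with h | h <;> rw [h] at e
    · refine e2 (mul_left_cancel₀ (pow_ne_zero 2 hAz) ?_)
      linear_combination e
    · refine e3 (mul_left_cancel₀ (pow_ne_zero 2 hAz) ?_)
      linear_combination e
  -- At the end |B| ≤ (ε/4)(2τ), while σA ≥ τ.
  have hend : |B (z τ)| - ε * (σ * A (z τ)) < 0 := by
    have hm : τ ∈ Icc 0 τ := ⟨hτ0.le, le_rfl⟩
    have e1 := (H _ (hzm τ hm)).2.2.2.2.2.2
    have e2 := hgrow τ hm
    have e3 := hnz τ hm
    nlinarith [abs_pos.2 hA0]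
  by_contra hcon
  push Not at hcon
  have hstart : 0 ≤ |B (z 0)| - ε * (σ * A (z 0)) := by
    simp only [hz, zero_smul, add_zero, hσA]
    linarith
  obtain ⟨t, ht, h0⟩ := intermediate_value_Icc' hτ0.le hψc ⟨hend.le, hstart⟩
  exact hψ0 t ht h0

/-! ### Fields of divergence 2 and their singular points -/

/-- A `C¹` vector field `(X, Y)` on `U` with divergence `2` whose direction is infinitesimally
constant along `(Y, -X)`. -/
structure IsField (X Y : ℝ × ℝ → ℝ) (U : Set (ℝ × ℝ)) : Prop where
  isOpen : IsOpen U
  contX : ContDiffOn ℝ 1 X U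
  contY : ContDiffOn ℝ 1 Y U
  div : ∀ p ∈ U, fderiv ℝ X p (1, 0) + fderiv ℝ Y p (0, 1) = 2
  eqn : ∀ p ∈ U, fderiv ℝ X p (1, 0) * Y p ^ 2
    - X p * Y p * (fderiv ℝ X p (0, 1) + fderiv ℝ Y p (1, 0)) + fderiv ℝ Y p (0, 1) * X p ^ 2 = 0

namespace IsField

variable {X Y : ℝ × ℝ → ℝ} {U : Set (ℝ × ℝ)} {p : ℝ × ℝ}

theorem hasFDerivAt_fst (hF : IsField X Y U) (hp : p ∈ U) : HasFDerivAt X (fderiv ℝ X p) p :=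
  ((hF.contX.differentiableOn one_ne_zero).differentiableAt (hF.isOpen.mem_nhds hp)).hasFDerivAt

theorem hasFDerivAt_snd (hF : IsField X Y U) (hp : p ∈ U) : HasFDerivAt Y (fderiv ℝ Y p) p :=
  ((hF.contY.differentiableOn one_ne_zero).differentiableAt (hF.isOpen.mem_nhds hp)).hasFDerivAt

theorem continuousAt_fderiv_fst (hF : IsField X Y U) (hp : p ∈ U) :
    ContinuousAt (fderiv ℝ X) p :=
  (hF.contX.continuousOn_fderiv_of_isOpen hF.isOpen le_rfl).continuousAt (hF.isOpen.mem_nhds hp)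

theorem continuousAt_fderiv_snd (hF : IsField X Y U) (hp : p ∈ U) :
    ContinuousAt (fderiv ℝ Y) p :=
  (hF.contY.continuousOn_fderiv_of_isOpen hF.isOpen le_rfl).continuousAt (hF.isOpen.mem_nhds hp)

theorem eventually_mem (hF : IsField X Y U) (hp : p ∈ U) : ∀ᶠ q in 𝓝 p, q ∈ U :=
  hF.isOpen.mem_nhds hp

/-- Evaluate the equation at p + tv, divide by t² and let t → 0: V/t tends to DV v, and the
coefficients are continuous. -/
theorem eqn_deriv (hF : IsField X Y U) (hp : p ∈ U) (hX : X p = 0) (hY : Y p = 0) (v : ℝ × ℝ) :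
    fderiv ℝ X p (1, 0) * (fderiv ℝ Y p v) ^ 2
      - fderiv ℝ X p v * fderiv ℝ Y p v * (fderiv ℝ X p (0, 1) + fderiv ℝ Y p (1, 0))
      + fderiv ℝ Y p (0, 1) * (fderiv ℝ X p v) ^ 2 = 0 := by
  have tX := ((hF.hasFDerivAt_fst hp).hasLineDerivAt v).tendsto_slope_zero
  have tY := ((hF.hasFDerivAt_snd hp).hasLineDerivAt v).tendsto_slope_zero
  have tp : Tendsto (fun t : ℝ => p + t • v) (𝓝[≠] 0) (𝓝 p) := by
    have : Continuous (fun t : ℝ => p + t • v) := by fun_prop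
    simpa using (this.tendsto 0).mono_left nhdsWithin_le_nhds
  have tD : ∀ w : ℝ × ℝ, Tendsto (fun t : ℝ => fderiv ℝ X (p + t • v) w) (𝓝[≠] 0)
      (𝓝 (fderiv ℝ X p w)) := fun w =>
    ((hF.continuousAt_fderiv_fst hp).clm_apply continuousAt_const).tendsto.comp tp
  have tE : ∀ w : ℝ × ℝ, Tendsto (fun t : ℝ => fderiv ℝ Y (p + t • v) w) (𝓝[≠] 0)
      (𝓝 (fderiv ℝ Y p w)) := fun w =>
    ((hF.continuousAt_fderiv_snd hp).clm_apply continuousAt_const).tendsto.comp tp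
  have lim := (((tD (1, 0)).mul (tY.pow 2)).sub ((tX.mul tY).mul ((tD (0, 1)).add (tE (1, 0))))).add
    ((tE (0, 1)).mul (tX.pow 2))
  refine tendsto_nhds_unique lim (tendsto_const_nhds.congr' ?_)
  filter_upwards [tp.eventually (hF.eventually_mem hp)] with t ht
  have := hF.eqn _ ht
  simp only [hX, hY, sub_zero, smul_eq_mul]
  linear_combination -(t⁻¹) ^ 2 * this

/-- For v = (1, 0) and v = (0, 1) the limiting equation reads X_x det = 0 and Y_y det = 0. Their sum
is 2 det = 0 by the divergence condition. -/
theorem det_eq_zero (hF : IsField X Y U) (hp : p ∈ U) (hX : X p = 0) (hY : Y p = 0) :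
    fderiv ℝ X p (1, 0) * fderiv ℝ Y p (0, 1) = fderiv ℝ X p (0, 1) * fderiv ℝ Y p (1, 0) := by
  have h1 := hF.eqn_deriv hp hX hY (1, 0)
  have h2 := hF.eqn_deriv hp hX hY (0, 1)
  have h3 := hF.div p hp
  linear_combination (h1 + h2) / 2 - (fderiv ℝ X p (1, 0) * fderiv ℝ Y p (0, 1) -
    fderiv ℝ X p (0, 1) * fderiv ℝ Y p (1, 0)) / 2 * h3

end IsField

/-- Near `p`, the vectors `(X, Y)` that do not vanish are almost parallel to `(c, s)`. -/
def IsLimitDirection (X Y : ℝ × ℝ → ℝ) (p : ℝ × ℝ) (c s : ℝ) : Prop :=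
  c ^ 2 + s ^ 2 = 1 ∧ ∀ ε > 0, ∀ᶠ q in 𝓝 p, X q ≠ 0 ∨ Y q ≠ 0 →
    c * X q + s * Y q ≠ 0 ∧ |-s * X q + c * Y q| ≤ ε * |c * X q + s * Y q|

theorem exists_unit_of_ne {a b : ℝ} (h : a ≠ 0 ∨ b ≠ 0) :
    ∃ r c s : ℝ, 0 < r ∧ c ^ 2 + s ^ 2 = 1 ∧ a = r * c ∧ b = r * s := by
  have hpos : 0 < a ^ 2 + b ^ 2 := by
    rcases h with h | h <;> positivity
  have hr : 0 < √(a ^ 2 + b ^ 2) := Real.sqrt_pos.2 hpos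
  refine ⟨√(a ^ 2 + b ^ 2), a / √(a ^ 2 + b ^ 2), b / √(a ^ 2 + b ^ 2), hr, ?_, ?_, ?_⟩
  · rw [div_pow, div_pow, Real.sq_sqrt hpos.le, ← add_div, div_self hpos.ne']
  · field_simp
  · field_simp

theorem isLimitDirection_of_ne {X Y : ℝ × ℝ → ℝ} {p : ℝ × ℝ} {r c s : ℝ} (hX : ContinuousAt X p)
    (hY : ContinuousAt Y p) (hr : 0 < r) (hcs : c ^ 2 + s ^ 2 = 1) (h1 : X p = r * c)
    (h2 : Y p = r * s) : IsLimitDirection X Y p c s := by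
  refine ⟨hcs, fun ε hε => ?_⟩
  have hc : ContinuousAt (fun q => ε * |c * X q + s * Y q| - |-s * X q + c * Y q|) p := by fun_prop
  have hpos : 0 < ε * |c * X p + s * Y p| - |-s * X p + c * Y p| := by
    rw [h1, h2, show c * (r * c) + s * (r * s) = r * (c ^ 2 + s ^ 2) by ring, hcs,
      show -s * (r * c) + c * (r * s) = 0 by ring, abs_zero, sub_zero, mul_one]
    positivity
  filter_upwards [hc.eventually_const_lt hpos] with q hq _
  refine ⟨fun h0 => ?_, by linarith⟩
  rw [h0, abs_zero, mul_zero] at hq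
  linarith [abs_nonneg (-s * X q + c * Y q)]

namespace IsField

variable {X Y : ℝ × ℝ → ℝ} {U : Set (ℝ × ℝ)} {p : ℝ × ℝ}

/-- DV has determinant 0 and trace 2, hence rank one; (c, s) is a nonzero column, normalised, and
spans the range. -/
theorem exists_frame (hF : IsField X Y U) (hp : p ∈ U) (hX : X p = 0) (hY : Y p = 0) :
    ∃ c s : ℝ, c ^ 2 + s ^ 2 = 1 ∧ s * fderiv ℝ X p (1, 0) = c * fderiv ℝ Y p (1, 0) ∧
      s * fderiv ℝ X p (0, 1) = c * fderiv ℝ Y p (0, 1) := by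
  have hdet := hF.det_eq_zero hp hX hY
  have hdiv := hF.div p hp
  by_cases h0 : fderiv ℝ X p (1, 0) = 0
  · obtain ⟨r, c, s, hr, hcs, h1, h2⟩ := exists_unit_of_ne
      (a := fderiv ℝ X p (0, 1)) (b := fderiv ℝ Y p (0, 1)) (Or.inr fun h => by simp [h0, h] at hdiv)
    refine ⟨c, s, hcs, mul_left_cancel₀ hr.ne' ?_, by rw [h1, h2]; ring⟩
    linear_combination hdet - fderiv ℝ X p (1, 0) * h2 + fderiv ℝ Y p (1, 0) * h1
  · obtain ⟨r, c, s, hr, hcs, h1, h2⟩ := exists_unit_of_ne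
      (a := fderiv ℝ X p (1, 0)) (b := fderiv ℝ Y p (1, 0)) (Or.inl h0)
    refine ⟨c, s, hcs, by rw [h1, h2]; ring, mul_left_cancel₀ hr.ne' ?_⟩
    linear_combination -hdet - fderiv ℝ X p (0, 1) * h2 + fderiv ℝ Y p (0, 1) * h1

theorem isLimitDirection_of_eq_zero (hF : IsField X Y U) (hp : p ∈ U) (hX : X p = 0)
    (hY : Y p = 0) {c s : ℝ} (hcs : c ^ 2 + s ^ 2 = 1)
    (h1 : s * fderiv ℝ X p (1, 0) = c * fderiv ℝ Y p (1, 0))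
    (h2 : s * fderiv ℝ X p (0, 1) = c * fderiv ℝ Y p (0, 1)) : IsLimitDirection X Y p c s := by
  have hdiv := hF.div p hp
  have hn : ‖((c, s) : ℝ × ℝ)‖ ≤ 1 := by
    rw [Prod.norm_def]
    exact max_le (by simpa using (abs_le_of_sq_le_sq (a := c) (b := 1) (by nlinarith [sq_nonneg s]) one_pos.le)) (by simpa using (abs_le_of_sq_le_sq (a := s) (b := 1) (by nlinarith [sq_nonneg c]) one_pos.le))
  have hvec : ∀ (L : ℝ × ℝ →L[ℝ] ℝ) (a b : ℝ), L (a, b) = a * L (1, 0) + b * L (0, 1) := by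
    intro L a b
    rw [show ((a, b) : ℝ × ℝ) = a • (1, 0) + b • (0, 1) by simp, map_add, map_smul, map_smul,
      smul_eq_mul, smul_eq_mul]
  have key : ∀ ε : ℝ, 0 < ε → 2 * ε ≠ |(c • fderiv ℝ X p + s • fderiv ℝ Y p) (-s, c)| →
      ∀ᶠ q in 𝓝 p, c * X q + s * Y q ≠ 0 ∨ -s * X q + c * Y q ≠ 0 → c * X q + s * Y q ≠ 0 ∧
        |-s * X q + c * Y q| ≤ ε * |c * X q + s * Y q| := by
    intro ε hε hne
    refine eventually_abs_le_of_ne (A := fun q => c * X q + s * Y q)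
      (B := fun q => -s * X q + c * Y q) (n := (c, s)) (k := (-s, c))
      (A' := fun q => c • fderiv ℝ X q + s • fderiv ℝ Y q)
      (B' := fun q => -s • fderiv ℝ X q + c • fderiv ℝ Y q) hn ?_ ?_ ?_ ?_ (by simp [hX, hY]) ?_ ?_
      ?_ hε hne
    · filter_upwards [hF.eventually_mem hp] with q hq
      exact ((hF.hasFDerivAt_fst hq).const_mul c).add ((hF.hasFDerivAt_snd hq).const_mul s)
    · filter_upwards [hF.eventually_mem hp] with q hq
      exact ((hF.hasFDerivAt_fst hq).const_mul (-s)).add ((hF.hasFDerivAt_snd hq).const_mul c)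
    · exact ((hF.continuousAt_fderiv_fst hp).const_smul c).add
        ((hF.continuousAt_fderiv_snd hp).const_smul s)
    · exact ((hF.continuousAt_fderiv_fst hp).const_smul (-s)).add
        ((hF.continuousAt_fderiv_snd hp).const_smul c)
    · refine ContinuousLinearMap.ext fun v => ?_
      obtain ⟨a, b⟩ := v
      simp only [_root_.add_apply, _root_.smul_apply, smul_eq_mul,
        _root_.zero_apply]
      rw [hvec _ a b, hvec (fderiv ℝ Y p) a b]
      linear_combination -a * h1 - b * h2
    · simp only [_root_.add_apply, _root_.smul_apply, smul_eq_mul]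
      rw [hvec _ c s, hvec (fderiv ℝ Y p) c s]
      linear_combination hdiv + (fderiv ℝ X p (1, 0) + fderiv ℝ Y p (0, 1)) * hcs - s * h1 + c * h2
    · filter_upwards [hF.eventually_mem hp] with q hq
      simp only [_root_.add_apply, _root_.smul_apply, smul_eq_mul]
      rw [hvec (fderiv ℝ X q) c s, hvec (fderiv ℝ Y q) c s, hvec (fderiv ℝ X q) (-s) c,
        hvec (fderiv ℝ Y q) (-s) c]
      linear_combination (c ^ 2 + s ^ 2) ^ 2 * hF.eqn q hq
  have hreg : ∀ q, X q ≠ 0 ∨ Y q ≠ 0 → c * X q + s * Y q ≠ 0 ∨ -s * X q + c * Y q ≠ 0 := by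
    intro q hq
    by_contra! hcon
    have hx : X q = 0 := by linear_combination c * hcon.1 - s * hcon.2 - X q * hcs
    have hy : Y q = 0 := by linear_combination s * hcon.1 + c * hcon.2 - Y q * hcs
    exact hq.elim (fun h => h hx) fun h => h hy
  refine ⟨hcs, fun ε hε => ?_⟩
  by_cases hne : 2 * ε = |(c • fderiv ℝ X p + s • fderiv ℝ Y p) (-s, c)|
  -- At the one excluded value of ε, the smaller ε/2 is admissible and gives a stronger bound.
  · filter_upwards [key (ε / 2) (half_pos hε) (by rw [← hne]; linarith)] with q hq hr
    obtain ⟨e1, e2⟩ := hq (hreg q hr)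
    exact ⟨e1, e2.trans (mul_le_mul_of_nonneg_right (by linarith) (abs_nonneg _))⟩
  · filter_upwards [key ε hε hne] with q hq hr using hq (hreg q hr)

theorem exists_isLimitDirection (hF : IsField X Y U) (hp : p ∈ U) :
    ∃ c s : ℝ, IsLimitDirection X Y p c s := by
  by_cases h : X p ≠ 0 ∨ Y p ≠ 0
  · obtain ⟨r, c, s, hr, hcs, h1, h2⟩ := exists_unit_of_ne h
    exact ⟨c, s, isLimitDirection_of_ne (hF.hasFDerivAt_fst hp).continuousAt
      (hF.hasFDerivAt_snd hp).continuousAt hr hcs h1 h2⟩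
  · push Not at h
    obtain ⟨c, s, hcs, h1, h2⟩ := hF.exists_frame hp h.1 h.2
    exact ⟨c, s, hF.isLimitDirection_of_eq_zero hp h.1 h.2 hcs h1 h2⟩

/-- A field vanishing near p would have divergence 0 there, not 2. -/
theorem mem_closure_regular (hF : IsField X Y U) (hp : p ∈ U) :
    p ∈ closure {q | q ∈ U ∧ (X q ≠ 0 ∨ Y q ≠ 0)} := by
  by_contra hcon
  rw [mem_closure_iff_frequently, not_frequently] at hcon
  have hz : ∀ᶠ q in 𝓝 p, X q = 0 ∧ Y q = 0 := by
    filter_upwards [hcon, hF.eventually_mem hp] with q h1 h2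
    by_contra h3
    exact h1 ⟨h2, by tauto⟩
  have eX : X =ᶠ[𝓝 p] fun _ => 0 := hz.mono fun q hq => hq.1
  have eY : Y =ᶠ[𝓝 p] fun _ => 0 := hz.mono fun q hq => hq.2
  have := hF.div p hp
  rw [eX.fderiv_eq, eY.fderiv_eq] at this
  simp at this

end IsField

theorem abs_le_of_abs_add_le {m₁ m₂ d₁ d₂ : ℝ} (hm : m₁ ≠ 0)
    (h : |m₁ * d₁ + m₂ * d₂| ≤ |m₁| / 2 * max |d₁| |d₂|) :
    |d₁| ≤ (2 * |m₂| / |m₁| + 1) * |d₂| := by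
  have hpos : 0 < |m₁| := abs_pos.2 hm
  have h1 : |m₁| * |d₁| ≤ |m₁ * d₁ + m₂ * d₂| + |m₂| * |d₂| := by
    rw [← abs_mul, ← abs_mul]
    calc |m₁ * d₁| = |(m₁ * d₁ + m₂ * d₂) - m₂ * d₂| := by ring_nf
      _ ≤ _ := abs_sub _ _
  have h2 : max |d₁| |d₂| ≤ |d₁| + |d₂| :=
    max_le (by linarith [abs_nonneg d₂]) (by linarith [abs_nonneg d₁])
  have h3 : |m₁| / 2 * max |d₁| |d₂| ≤ |m₁| / 2 * (|d₁| + |d₂|) :=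
    mul_le_mul_of_nonneg_left h2 (by positivity)
  rw [show (2 * |m₂| / |m₁| + 1) * |d₂| = (2 * |m₂| * |d₂| + |m₁| * |d₂|) / |m₁| by
    field_simp, le_div_iff₀ hpos]
  linarith

/-- Points of a level set near a point where some partial derivative does not vanish. -/
theorem eventually_abs_sub_le {Z : ℝ × ℝ → ℝ} {L : ℝ × ℝ →L[ℝ] ℝ} {p : ℝ × ℝ}
    (hZ : HasStrictFDerivAt Z L p) {ε : ℝ} (hε : 0 < ε) :
    ∃ t ∈ 𝓝 p, ∀ q ∈ t, ∀ q' ∈ t, Z q = 0 → Z q' = 0 →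
      |L (1, 0) * (q.1 - q'.1) + L (0, 1) * (q.2 - q'.2)| ≤
        ε * max |q.1 - q'.1| |q.2 - q'.2| := by
  obtain ⟨t, ht, happ⟩ := hZ.approximates_deriv_on_nhds (c := ε.toNNReal)
    (Or.inr (Real.toNNReal_pos.2 hε))
  refine ⟨t, ht, fun q hq q' hq' h h' => ?_⟩
  have h1 := happ q hq q' hq'
  have h2 : L (q - q') = L (1, 0) * (q.1 - q'.1) + L (0, 1) * (q.2 - q'.2) := by
    rw [show q - q' = (q.1 - q'.1) • (1, 0) + (q.2 - q'.2) • (0, 1) by ext <;> simp, map_add,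
      map_smul, map_smul, smul_eq_mul, smul_eq_mul, mul_comm, mul_comm (q.2 - q'.2)]
  rw [h, h', sub_self, zero_sub, norm_neg, h2] at h1
  simpa [Prod.norm_def, Real.coe_toNNReal ε hε.le] using h1

namespace IsField

variable {X Y : ℝ × ℝ → ℝ} {U : Set (ℝ × ℝ)} {p : ℝ × ℝ}

/-- Since X_x + Y_y = 2, one of the two is nonzero at p. The zeros of V lie in the zero set of that
component, where strict differentiability bounds one coordinate increment by the other. -/
theorem singular_thin (hF : IsField X Y U) (hp : p ∈ U) : ∃ t ∈ 𝓝 p, ∃ K : ℝ, 0 ≤ K ∧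
    ((∀ q ∈ {q | X q = 0 ∧ Y q = 0} ∩ t, ∀ q' ∈ {q | X q = 0 ∧ Y q = 0} ∩ t,
        |q.1 - q'.1| ≤ K * |q.2 - q'.2|) ∨
      ∀ q ∈ {q | X q = 0 ∧ Y q = 0} ∩ t, ∀ q' ∈ {q | X q = 0 ∧ Y q = 0} ∩ t,
        |q.2 - q'.2| ≤ K * |q.1 - q'.1|) := by
  have hU := hF.isOpen.mem_nhds hp
  by_cases h0 : fderiv ℝ X p (1, 0) = 0
  · have h1 : fderiv ℝ Y p (0, 1) ≠ 0 := fun h => by simpa [h0, h] using hF.div p hp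
    obtain ⟨t, ht, H⟩ := eventually_abs_sub_le
      ((hF.contY.contDiffAt hU).hasStrictFDerivAt one_ne_zero) (half_pos (abs_pos.2 h1))
    refine ⟨t, ht, _, by positivity, Or.inr fun q hq q' hq' => abs_le_of_abs_add_le h1
      (m₂ := fderiv ℝ Y p (1, 0)) ?_⟩
    rw [add_comm, max_comm]
    exact H q hq.2 q' hq'.2 hq.1.2 hq'.1.2
  · obtain ⟨t, ht, H⟩ := eventually_abs_sub_le
      ((hF.contX.contDiffAt hU).hasStrictFDerivAt one_ne_zero) (half_pos (abs_pos.2 h0))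
    exact ⟨t, ht, _, by positivity, Or.inl fun q hq q' hq' => abs_le_of_abs_add_le h0
      (m₂ := fderiv ℝ X p (0, 1)) (H q hq.2 q' hq'.2 hq.1.1 hq'.1.1)⟩

end IsField

/-! ### The extended direction as a gradient -/

/-- The slope of `(X, Y)` in the orthonormal frame `(c, s)`, `(-s, c)`. -/
noncomputable def frameSlope (X Y : ℝ × ℝ → ℝ) (c s : ℝ) (q : ℝ × ℝ) : ℝ :=
  (-s * X q + c * Y q) / (c * X q + s * Y q)

/-- If `(X, Y)` has a limit direction at `q` and a bounded slope in another frame, then the slope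
in that frame converges. -/
theorem exists_tendsto_slope {X Y : ℝ × ℝ → ℝ} {R : Set (ℝ × ℝ)} {q : ℝ × ℝ} {c s c' s' : ℝ}
    (hR : ∀ z ∈ R, X z ≠ 0 ∨ Y z ≠ 0) (hq : q ∈ closure R) (hcs : c ^ 2 + s ^ 2 = 1)
    (hb : ∀ᶠ z in 𝓝[R] q, |-s * X z + c * Y z| ≤ |c * X z + s * Y z|)
    (hd : IsLimitDirection X Y q c' s') :
    ∃ y, Tendsto (frameSlope X Y c s) (𝓝[R] q) (𝓝 y) := by
  have := mem_closure_iff_nhdsWithin_neBot.1 hq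
  have hcs' := hd.1
  have hRR : ∀ᶠ z in 𝓝[R] q, X z ≠ 0 ∨ Y z ≠ 0 := by
    filter_upwards [self_mem_nhdsWithin] with z hz using hR z hz
  have hne : ∀ᶠ z in 𝓝[R] q, c' * X z + s' * Y z ≠ 0 := by
    filter_upwards [hRR, nhdsWithin_le_nhds (hd.2 1 one_pos)] with z h1 h2 using (h2 h1).1
  have ht : Tendsto (frameSlope X Y c' s') (𝓝[R] q) (𝓝 0) := by
    rw [Metric.tendsto_nhds]
    intro ε hε
    filter_upwards [hRR, nhdsWithin_le_nhds (hd.2 (ε / 2) (half_pos hε))] with z h1 h2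
    obtain ⟨h3, h4⟩ := h2 h1
    rw [Real.dist_eq, sub_zero, frameSlope, abs_div, div_lt_iff₀ (abs_pos.2 h3)]
    have := abs_pos.2 h3
    nlinarith
  set a := c * c' + s * s' with ha
  set b := c * s' - s * c' with hb'
  have hab : a ^ 2 + b ^ 2 = 1 := by
    rw [ha, hb']
    linear_combination (c' ^ 2 + s' ^ 2) * hcs + hcs'
  have eA : ∀ z, c * X z + s * Y z =
      a * (c' * X z + s' * Y z) - b * (-s' * X z + c' * Y z) := fun z => by
    rw [ha, hb']
    linear_combination -(c * X z + s * Y z) * hcs'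
  have eB : ∀ z, -s * X z + c * Y z =
      b * (c' * X z + s' * Y z) + a * (-s' * X z + c' * Y z) := fun z => by
    rw [ha, hb']
    linear_combination -(-s * X z + c * Y z) * hcs'
  -- A change of frame acts on slopes by the Möbius map m ↦ (b + am)/(a - bm). The bound by 1 passes
  -- to the limit m = 0 and gives |b| ≤ |a|, so a ≠ 0 and there is no pole.
  have hle : |b + a * 0| ≤ |a - b * 0| := by
    refine le_of_tendsto_of_tendsto ((ht.const_mul a).const_add b).abs
      ((ht.const_mul b).const_sub a).abs ?_
    filter_upwards [hb, hne] with z h1 h2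
    rw [eA, eB] at h1
    have h3 := abs_pos.2 h2
    refine le_of_mul_le_mul_right ?_ h3
    rw [← abs_mul, ← abs_mul]
    have e0 : frameSlope X Y c' s' z * (c' * X z + s' * Y z) = -s' * X z + c' * Y z :=
      div_mul_cancel₀ _ h2
    have e1 : (b + a * frameSlope X Y c' s' z) * (c' * X z + s' * Y z) =
        b * (c' * X z + s' * Y z) + a * (-s' * X z + c' * Y z) := by
      linear_combination a * e0
    have e2 : (a - b * frameSlope X Y c' s' z) * (c' * X z + s' * Y z) =
        a * (c' * X z + s' * Y z) - b * (-s' * X z + c' * Y z) := by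
      linear_combination -b * e0
    rwa [e1, e2]
  rw [mul_zero, add_zero, mul_zero, sub_zero] at hle
  have ha0 : a - b * 0 ≠ 0 := by
    rw [mul_zero, sub_zero]
    intro h0
    rw [h0, abs_zero] at hle
    have : b = 0 := abs_eq_zero.1 (le_antisymm hle (abs_nonneg b))
    simp [h0, this] at hab
  refine ⟨_, (((ht.const_mul a).const_add b).div ((ht.const_mul b).const_sub a) ha0).congr' ?_⟩
  filter_upwards [hne] with z h2
  have e0 : frameSlope X Y c' s' z * (c' * X z + s' * Y z) = -s' * X z + c' * Y z :=
    div_mul_cancel₀ _ h2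
  have e1 : b * (c' * X z + s' * Y z) + a * (-s' * X z + c' * Y z) =
      (b + a * frameSlope X Y c' s' z) * (c' * X z + s' * Y z) := by
    linear_combination -a * e0
  have e2 : a * (c' * X z + s' * Y z) - b * (-s' * X z + c' * Y z) =
      (a - b * frameSlope X Y c' s' z) * (c' * X z + s' * Y z) := by
    linear_combination b * e0
  have e3 : frameSlope X Y c s z = (-s * X z + c * Y z) / (c * X z + s * Y z) := rfl
  rw [e3, eA, eB, e1, e2, mul_div_mul_right _ _ h2]
  rfl

/-- The unit vector orthogonal to `(c, s) + x (-s, c)`, as a function of `x`. -/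
noncomputable def unitOfSlope (c s x : ℝ) : ℝ × ℝ :=
  ((x * c + s) / √(1 + x ^ 2), (x * s - c) / √(1 + x ^ 2))

theorem sqrt_one_add_sq_pos (x : ℝ) : 0 < √(1 + x ^ 2) := Real.sqrt_pos.2 (by positivity)

theorem continuous_unitOfSlope (c s : ℝ) : Continuous (unitOfSlope c s) := by
  unfold unitOfSlope
  exact (by fun_prop : Continuous fun x : ℝ => x * c + s).div (by fun_prop)
    (fun x => (sqrt_one_add_sq_pos x).ne') |>.prodMk
    ((by fun_prop : Continuous fun x : ℝ => x * s - c).div (by fun_prop)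
    (fun x => (sqrt_one_add_sq_pos x).ne'))

theorem unitOfSlope_norm {c s : ℝ} (hcs : c ^ 2 + s ^ 2 = 1) (x : ℝ) :
    (unitOfSlope c s x).1 ^ 2 + (unitOfSlope c s x).2 ^ 2 = 1 := by
  have h : 0 < 1 + x ^ 2 := by positivity
  simp only [unitOfSlope]
  rw [div_pow, div_pow, Real.sq_sqrt h.le, ← add_div, div_eq_one_iff_eq h.ne']
  linear_combination (1 + x ^ 2) * hcs

theorem hasDerivAt_div_sqrt (a b x : ℝ) :
    HasDerivAt (fun x : ℝ => (x * a + b) / √(1 + x ^ 2)) ((a - b * x) / √(1 + x ^ 2) ^ 3) x := by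
  have hpos : 0 < 1 + x ^ 2 := by positivity
  have h1 : HasDerivAt (fun x : ℝ => x * a + b) a x := by
    simpa using ((hasDerivAt_id x).mul_const a).add_const b
  have h2 : HasDerivAt (fun x : ℝ => √(1 + x ^ 2)) (2 * x / (2 * √(1 + x ^ 2))) x := by
    have : HasDerivAt (fun x : ℝ => 1 + x ^ 2) (2 * x) x := by
      simpa using (hasDerivAt_pow 2 x).const_add 1
    exact this.sqrt hpos.ne'
  have h3 := sqrt_one_add_sq_pos x
  have h4 := Real.sq_sqrt hpos.le
  refine (h1.div h2 h3.ne').congr_deriv ?_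
  set r := √(1 + x ^ 2)
  field_simp
  linear_combination a * h4

/-- The components of `unitOfSlope` have derivatives (c - sx)/(1 + x²)^(3/2) and (s + cx)/(1 +
x²)^(3/2), so the Burgers equation `h` for the slope is the closedness condition. -/
theorem closedAt_unitOfSlope {γ : ℝ × ℝ → ℝ} {γ' : ℝ × ℝ →L[ℝ] ℝ} {q : ℝ × ℝ} {c s : ℝ}
    (hγ : HasFDerivAt γ γ' q) (h : (c - s * γ q) * γ' (0, 1) = (s + c * γ q) * γ' (1, 0)) :
    ClosedAt (fun z => (unitOfSlope c s (γ z)).1) (fun z => (unitOfSlope c s (γ z)).2) q := by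
  refine ⟨_, _, (hasDerivAt_div_sqrt c s (γ q)).comp_hasFDerivAt q hγ,
    (hasDerivAt_div_sqrt s (-c) (γ q)).comp_hasFDerivAt q hγ, ?_⟩
  simp only [_root_.smul_apply, smul_eq_mul]
  rw [div_mul_eq_mul_div, div_mul_eq_mul_div, h]
  ring

namespace IsField

variable {X Y : ℝ × ℝ → ℝ} {U : Set (ℝ × ℝ)} {p : ℝ × ℝ}

/-- Away from the singular set, the slope satisfies an inviscid Burgers equation. -/
theorem exists_hasFDerivAt_slope (hF : IsField X Y U) {q : ℝ × ℝ} (hq : q ∈ U) {c s : ℝ}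
    (hcs : c ^ 2 + s ^ 2 = 1) (hne : c * X q + s * Y q ≠ 0) :
    ∃ γ' : ℝ × ℝ →L[ℝ] ℝ, HasFDerivAt (frameSlope X Y c s) γ' q ∧
      (c - s * frameSlope X Y c s q) * γ' (0, 1) = (s + c * frameSlope X Y c s q) * γ' (1, 0) := by
  have hA := ((hF.hasFDerivAt_fst hq).const_mul c).add ((hF.hasFDerivAt_snd hq).const_mul s)
  have hB := ((hF.hasFDerivAt_fst hq).const_mul (-s)).add ((hF.hasFDerivAt_snd hq).const_mul c)
  have hI := (hasDerivAt_inv hne).comp_hasFDerivAt q hA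
  have hM := hB.mul hI
  refine ⟨_, hM, ?_⟩
  have heq := hF.eqn q hq
  set A := c * X q + s * Y q with hAdef
  set B := -s * X q + c * Y q with hBdef
  have hX : c * A - s * B = X q := by rw [hAdef, hBdef]; linear_combination X q * hcs
  have hY : s * A + c * B = Y q := by rw [hAdef, hBdef]; linear_combination Y q * hcs
  have hslope : frameSlope X Y c s q = B / A := rfl
  simp only [hslope, Function.comp_apply, Pi.add_apply, _root_.add_apply, _root_.smul_apply,
    smul_eq_mul, ← hAdef, ← hBdef]
  field_simp
  rw [hX, hY]
  linear_combination heq + X q * (fderiv ℝ Y q (0, 1) * hX - fderiv ℝ X q (0, 1) * hY) -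
    Y q * (fderiv ℝ Y q (1, 0) * hX - fderiv ℝ X q (1, 0) * hY)

/-- In the frame given by the limit direction at p, the slope is bounded by 1 nearby and converges
at every point, so it extends continuously. The resulting unit form is closed off the thin singular
set, hence exact. -/
theorem exists_direction (hF : IsField X Y U) (hp : p ∈ U) :
    ∃ δ > 0, ball p δ ⊆ U ∧ ∃ T : ℝ × ℝ → ℝ × ℝ, ContinuousOn T (ball p δ) ∧
      (∀ q ∈ ball p δ, (T q).1 ^ 2 + (T q).2 ^ 2 = 1) ∧
      (∀ q ∈ ball p δ, X q ≠ 0 ∨ Y q ≠ 0 → (T q).1 * X q + (T q).2 * Y q = 0) ∧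
      ∃ u : ℝ × ℝ → ℝ, ∀ q ∈ ball p δ, HasFDerivAt u (form (T q).1 (T q).2) q := by
  obtain ⟨c, s, hcs, hlim⟩ := hF.exists_isLimitDirection hp
  obtain ⟨t, ht, K, hK, hthin⟩ := hF.singular_thin hp
  obtain ⟨δ, hδ, hball⟩ := Metric.eventually_nhds_iff_ball.1
    ((hlim 1 one_pos).and ((hF.eventually_mem hp).and ht))
  set R := {q | q ∈ U ∧ (X q ≠ 0 ∨ Y q ≠ 0)} with hR
  set γ := extendFrom R (frameSlope X Y c s) with hγ
  have hcl : ball p δ ⊆ closure R := fun q hq => hF.mem_closure_regular (hball q hq).2.1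
  have htend : ∀ q ∈ ball p δ, ∃ y, Tendsto (frameSlope X Y c s) (𝓝[R] q) (𝓝 y) := by
    intro q hq
    obtain ⟨c', s', h'⟩ := hF.exists_isLimitDirection (hball q hq).2.1
    refine exists_tendsto_slope (fun z hz => hz.2) (hcl hq) hcs ?_ h'
    filter_upwards [self_mem_nhdsWithin, mem_nhdsWithin_of_mem_nhds (isOpen_ball.mem_nhds hq)]
      with z hz hzb
    simpa using ((hball z hzb).1 hz.2).2
  have hγc : ContinuousOn γ (ball p δ) := continuousOn_extendFrom hcl htend
  have hγeq : ∀ q ∈ ball p δ, X q ≠ 0 ∨ Y q ≠ 0 → γ q = frameSlope X Y c s q := by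
    intro q hq hreg
    have hqU := (hball q hq).2.1
    obtain ⟨γ', h1, -⟩ := hF.exists_hasFDerivAt_slope hqU hcs ((hball q hq).1 hreg).1
    exact extendFrom_eq (hcl hq) (h1.continuousAt.tendsto.mono_left nhdsWithin_le_nhds)
  have hTc : ContinuousOn (fun q => unitOfSlope c s (γ q)) (ball p δ) :=
    (continuous_unitOfSlope c s).comp_continuousOn hγc
  refine ⟨δ, hδ, fun q hq => (hball q hq).2.1, fun q => unitOfSlope c s (γ q), hTc,
    fun q _ => unitOfSlope_norm hcs _, ?_, ?_⟩
  · intro q hq hreg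
    have hne := ((hball q hq).1 hreg).1
    have h3 := sqrt_one_add_sq_pos (γ q)
    simp only [unitOfSlope]
    rw [div_mul_eq_mul_div, div_mul_eq_mul_div, ← add_div, div_eq_zero_iff]
    left
    have : γ q * (c * X q + s * Y q) = -s * X q + c * Y q := by
      rw [hγeq q hq hreg, frameSlope, div_mul_cancel₀ _ hne]
    linear_combination this
  · refine exists_potential (S := {q | X q = 0 ∧ Y q = 0}) hK hTc.fst hTc.snd ?_ ?_
    · have hsub : ball p δ ⊆ t := fun q hq => (hball q hq).2.2
      exact hthin.imp (fun h q hq q' hq' => h q ⟨hq.1, hsub hq.2⟩ q' ⟨hq'.1, hsub hq'.2⟩)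
        fun h q hq q' hq' => h q ⟨hq.1, hsub hq.2⟩ q' ⟨hq'.1, hsub hq'.2⟩
    · intro q hq hqS
      have hreg : X q ≠ 0 ∨ Y q ≠ 0 := by
        by_contra h; exact hqS (by simpa using h)
      have hqU := (hball q hq).2.1
      obtain ⟨γ', h1, h2⟩ := hF.exists_hasFDerivAt_slope hqU hcs ((hball q hq).1 hreg).1
      have hev : γ =ᶠ[𝓝 q] frameSlope X Y c s := by
        have hc : ∀ᶠ z in 𝓝 q, X z ≠ 0 ∨ Y z ≠ 0 := by
          rcases hreg with h | h
          · exact ((hF.hasFDerivAt_fst hqU).continuousAt.eventually_ne h).mono fun z => Or.inl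
          · exact ((hF.hasFDerivAt_snd hqU).continuousAt.eventually_ne h).mono fun z => Or.inr
        filter_upwards [hc, isOpen_ball.mem_nhds hq] with z h3 h4 using hγeq z h4 h3
      exact closedAt_unitOfSlope (h1.congr_of_eventuallyEq hev) (by rw [hγeq q hq hreg]; exact h2)

/-- Near each point there is a continuous unit vector field orthogonal to `(X, Y)`, constant along
the straight segments tangent to it. -/
theorem exists_local_direction (hF : IsField X Y U) (hp : p ∈ U) :
    ∃ δ > 0, ball p δ ⊆ U ∧ ∃ T : ℝ × ℝ → ℝ × ℝ, ContinuousOn T (ball p δ) ∧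
      (∀ q ∈ ball p δ, (T q).1 ^ 2 + (T q).2 ^ 2 = 1) ∧
      (∀ q ∈ ball p δ, X q ≠ 0 ∨ Y q ≠ 0 → (T q).1 * X q + (T q).2 * Y q = 0) ∧
      ∀ q ∈ ball p δ, ∀ q' ∈ ball p δ,
        (q'.1 - q.1) * (T q).2 = (q'.2 - q.2) * (T q).1 → T q' = T q := by
  obtain ⟨δ, hδ, hU, T, hTc, hT1, hTV, u, hu⟩ := hF.exists_direction hp
  have hsub : ball p (δ / 8) ⊆ ball p δ := ball_subset_ball (by linarith)
  -- Two points of this ball differ by less than δ/4 in each coordinate, so the parameter s below is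
  -- at most δ/2, within the range of `eikonal_const_plane`.
  refine ⟨δ / 8, by positivity, hsub.trans hU, T, hTc.mono hsub, fun q hq => hT1 q (hsub hq),
    fun q hq => hTV q (hsub hq), fun q hq q' hq' hpar => ?_⟩
  have h1 := hT1 q (hsub hq)
  have hd : dist q' q < δ / 4 := by
    have := mem_ball.1 hq
    have := mem_ball'.1 hq'
    have := dist_triangle_left q' q p
    rw [dist_comm p q', dist_comm p q] at *
    linarith
  rw [Prod.dist_eq, max_lt_iff, Real.dist_eq, Real.dist_eq] at hd
  set s := (q'.1 - q.1) * (T q).1 + (q'.2 - q.2) * (T q).2 with hs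
  have hq'eq : q' = q + s • T q := by
    ext
    · simp only [Prod.fst_add, Prod.smul_fst, smul_eq_mul, hs]
      linear_combination (T q).2 * hpar - (q'.1 - q.1) * h1
    · simp only [Prod.snd_add, Prod.smul_snd, smul_eq_mul, hs]
      linear_combination -(T q).1 * hpar - (q'.2 - q.2) * h1
  have hsle : |s| ≤ δ / 2 := by
    have e1 : |(T q).1| ≤ 1 := abs_le_of_sq_le_sq (by nlinarith [sq_nonneg (T q).2]) one_pos.le
    have e2 : |(T q).2| ≤ 1 := abs_le_of_sq_le_sq (by nlinarith [sq_nonneg (T q).1]) one_pos.le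
    rw [hs]
    refine (abs_add_le _ _).trans ?_
    rw [abs_mul, abs_mul]
    nlinarith [abs_nonneg (q'.1 - q.1), abs_nonneg (q'.2 - q.2), abs_nonneg (T q).1]
  rw [hq'eq]
  exact eikonal_const_plane hu hT1 hTc q (ball_subset_ball (by linarith) hq) s hsle

end IsField

/-! ### Lines and quotients in ℝ ∪ {∞} -/

theorem gLine_infty (p : ℝ × ℝ) : gLine ∞ p = {q | q.2 = p.2} := rfl

theorem gLine_coe (r : ℝ) (p : ℝ × ℝ) :
    gLine (r : OnePoint ℝ) p = {q | q.1 = -r * (q.2 - p.2) + p.1} := rfl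

theorem hLine_infty (p : ℝ × ℝ) : hLine ∞ p = {q | q.1 = p.1} := rfl

theorem hLine_coe (r : ℝ) (p : ℝ × ℝ) :
    hLine (r : OnePoint ℝ) p = {q | q.2 = -r * (q.1 - p.1) + p.2} := rfl

theorem self_mem_gLine (m : OnePoint ℝ) (p : ℝ × ℝ) : p ∈ gLine m p := by
  induction m using OnePoint.rec with
  | infty => simp [gLine_infty]
  | coe r => simp [gLine_coe]

theorem gLine_eq_of_mem {m : OnePoint ℝ} {p q : ℝ × ℝ} (h : q ∈ gLine m p) :
    gLine m q = gLine m p := by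
  induction m using OnePoint.rec with
  | infty =>
    rw [gLine_infty, mem_ofPred_eq] at h
    rw [gLine_infty, gLine_infty, h]
  | coe r =>
    rw [gLine_coe, mem_ofPred_eq] at h
    rw [gLine_coe, gLine_coe]
    ext z
    simp only [mem_ofPred_eq]
    constructor <;> intro hz <;> linarith

theorem isLine_gLine (m : OnePoint ℝ) (p : ℝ × ℝ) : IsLine (gLine m p) := by
  induction m using OnePoint.rec with
  | infty => exact ⟨0, 1, p.2, by simp, by simp [gLine_infty]⟩
  | coe r =>
    refine ⟨1, r, r * p.2 + p.1, by simp, ?_⟩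
    rw [gLine_coe]
    ext z
    simp only [mem_ofPred_eq]
    constructor <;> intro hz <;> linarith

/-- For the tangent (a, b), orthogonal to V, one has g = -a/b and h = -b/a. This and `hLine_ratio`
identify both formulas with the line through p in direction (a, b), including the infinite cases. -/
theorem gLine_ratio {a b : ℝ} (hab : a ^ 2 + b ^ 2 = 1) (p : ℝ × ℝ) :
    gLine (ratio a (-b)) p = {q | (q.1 - p.1) * b = (q.2 - p.2) * a} := by
  by_cases hb : b = 0
  · have ha : a ≠ 0 := fun h => by simp [h, hb] at hab
    simp [ratio, hb, gLine_infty, ha, sub_eq_zero]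
  · rw [ratio, if_neg (neg_ne_zero.2 hb), gLine_coe]
    ext q
    simp only [mem_ofPred_eq]
    rw [← sub_eq_iff_eq_add, div_neg, neg_neg, div_mul_eq_mul_div, eq_div_iff hb, mul_comm a]

theorem hLine_ratio {a b : ℝ} (hab : a ^ 2 + b ^ 2 = 1) (p : ℝ × ℝ) :
    hLine (ratio (-b) a) p = {q | (q.1 - p.1) * b = (q.2 - p.2) * a} := by
  by_cases ha : a = 0
  · have hb : b ≠ 0 := fun h => by simp [h, ha] at hab
    simp [ratio, ha, hLine_infty, hb, sub_eq_zero]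
  · rw [ratio, if_neg ha, hLine_coe]
    ext q
    simp only [mem_ofPred_eq]
    rw [← sub_eq_iff_eq_add, neg_div, neg_neg, div_mul_eq_mul_div, eq_div_iff ha, mul_comm b]
    exact eq_comm

theorem ratio_eq_of_mul_eq {a b x y : ℝ} (h : y * b = a * x) (hab : a ≠ 0 ∨ b ≠ 0)
    (hxy : x ≠ 0 ∨ y ≠ 0) : ratio y x = ratio a b := by
  by_cases hx : x = 0
  · have hy := hxy.resolve_left (not_not.2 hx)
    have hb : b = 0 := by simpa [hx, hy] using h
    simp [ratio, hx, hb]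
  · have hb : b ≠ 0 := by
      rintro rfl
      rw [mul_zero, eq_comm, mul_eq_zero] at h
      exact hab.elim (fun h' => h.elim h' hx) fun h' => h' rfl
    rw [ratio, ratio, if_neg hx, if_neg hb, (div_eq_div_iff hx hb).2 h]

theorem tendsto_ratio {α : Type*} {l : Filter α} {a b : α → ℝ} {a₀ b₀ : ℝ}
    (ha : Tendsto a l (𝓝 a₀)) (hb : Tendsto b l (𝓝 b₀)) (h : a₀ ≠ 0 ∨ b₀ ≠ 0) :
    Tendsto (fun z => ratio (a z) (b z)) l (𝓝 (ratio a₀ b₀)) := by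
  by_cases hb₀ : b₀ = 0
  · have ha₀ : a₀ ≠ 0 := h.resolve_right (not_not.2 hb₀)
    rw [ratio, if_pos hb₀, OnePoint.hasBasis_nhds_infty.tendsto_right_iff]
    rintro s ⟨-, hs⟩
    -- A neighbourhood of ∞ omits only a bounded set of reals, and |a| > M|b| eventually because b →
    -- 0 and a₀ ≠ 0.
    obtain ⟨M, hM⟩ := hs.isBounded.exists_norm_le
    have h1 : Tendsto (fun z => |a z| - (M * |b z|)) l (𝓝 (|a₀| - M * |b₀|)) :=
      ha.abs.sub (hb.abs.const_mul M)
    have h2 : 0 < |a₀| - M * |b₀| := by simpa [hb₀] using ha₀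
    filter_upwards [h1.eventually_const_lt h2] with z hz
    by_cases hbz : b z = 0
    · simp [ratio, hbz]
    · rw [ratio, if_neg hbz]
      refine Or.inl ⟨a z / b z, fun hmem => ?_, rfl⟩
      have h3 := hM _ hmem
      rw [Real.norm_eq_abs, abs_div, div_le_iff₀ (abs_pos.2 hbz)] at h3
      linarith
  · rw [ratio, if_neg hb₀]
    have h1 : Tendsto (fun z => ((a z / b z : ℝ) : OnePoint ℝ)) l (𝓝 ((a₀ / b₀ : ℝ) : OnePoint ℝ)) :=
      (OnePoint.continuous_coe.tendsto _).comp (ha.div hb hb₀)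
    refine h1.congr' ?_
    filter_upwards [hb.eventually_ne hb₀] with z hz
    rw [ratio, if_neg hz]

/-! ### From a line field to a foliation -/

/-- `G` is a continuous field of directions on `U`, given near each point by a unit vector field
that is constant along the segments it spans. -/
structure IsLineField (G : ℝ × ℝ → OnePoint ℝ) (U : Set (ℝ × ℝ)) : Prop where
  cont : ContinuousOn G U
  unit : ∀ p ∈ U, ∃ δ > 0, ball p δ ⊆ U ∧ ∃ T : ℝ × ℝ → ℝ × ℝ, ContinuousOn T (ball p δ) ∧
    (∀ q ∈ ball p δ, (T q).1 ^ 2 + (T q).2 ^ 2 = 1) ∧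
    (∀ q ∈ ball p δ, G q = ratio (T q).1 (-(T q).2)) ∧
    ∀ q ∈ ball p δ, ∀ q' ∈ ball p δ,
      (q'.1 - q.1) * (T q).2 = (q'.2 - q.2) * (T q).1 → T q' = T q

/-- The leaf through `p`. -/
def leaf (G : ℝ × ℝ → OnePoint ℝ) (U : Set (ℝ × ℝ)) (p : ℝ × ℝ) : Set (ℝ × ℝ) :=
  connectedComponentIn (gLine (G p) p ∩ U) p

namespace IsLineField

variable {G : ℝ × ℝ → OnePoint ℝ} {U : Set (ℝ × ℝ)}

theorem mem_leaf {p : ℝ × ℝ} (hp : p ∈ U) : p ∈ leaf G U p :=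
  mem_connectedComponentIn ⟨self_mem_gLine _ _, hp⟩

theorem leaf_subset (p : ℝ × ℝ) : leaf G U p ⊆ gLine (G p) p ∩ U := connectedComponentIn_subset _ _

/-- Within the connected leaf, the set where G takes the value G p is closed by continuity, and open
because T is constant along short segments of the line. -/
theorem eq_of_mem_leaf (hG : IsLineField G U) {p q : ℝ × ℝ} (hp : p ∈ U) (hq : q ∈ leaf G U p) :
    G q = G p := by
  have : PreconnectedSpace (leaf G U p) :=
    Subtype.preconnectedSpace isPreconnected_connectedComponentIn
  have hc : Continuous fun z : leaf G U p => G z :=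
    (hG.cont.mono fun z hz => (leaf_subset p hz).2).domRestrict
  have hclopen : IsClopen {z : leaf G U p | G z = G p} := by
    refine ⟨isClosed_eq hc continuous_const, isOpen_iff_mem_nhds.2 fun z hz => ?_⟩
    obtain ⟨δ, hδ, -, T, -, hT1, hGT, hTc⟩ := hG.unit z (leaf_subset p z.2).2
    filter_upwards [continuous_subtype_val.continuousAt.preimage_mem_nhds
      (ball_mem_nhds (z : ℝ × ℝ) hδ)] with w hw
    have hz' : G z = G p := hz
    have hzb := mem_ball_self (x := (z : ℝ × ℝ)) hδ
    have hline : (w : ℝ × ℝ) ∈ gLine (G z) z := by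
      rw [hz', gLine_eq_of_mem (leaf_subset p z.2).1]
      exact (leaf_subset p w.2).1
    rw [hGT z hzb, gLine_ratio (hT1 z hzb)] at hline
    change G w = G p
    rw [hGT w hw, hTc z hzb w hw hline, ← hGT z hzb, hz']
  have := hclopen.eq_univ ⟨⟨p, mem_leaf hp⟩, rfl⟩
  exact (this.ge (mem_univ (⟨q, hq⟩ : leaf G U p)) :)

theorem leaf_eq_of_mem (hG : IsLineField G U) {p q : ℝ × ℝ} (hp : p ∈ U) (hq : q ∈ leaf G U p) :
    leaf G U q = leaf G U p := by
  rw [leaf, hG.eq_of_mem_leaf hp hq, gLine_eq_of_mem (leaf_subset p hq).1]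
  exact (connectedComponentIn_eq hq).symm

theorem exists_chart (hG : IsLineField G U) {p : ℝ × ℝ} (hp : p ∈ U) :
    ∃ e : OpenPartialHomeomorph (ℝ × ℝ) (ℝ × ℝ), p ∈ e.source ∧ e.source ⊆ U ∧
      ∃ s₀ s₁ t₀ t₁ : ℝ, e.target = Ioo s₀ s₁ ×ˢ Ioo t₀ t₁ ∧
        ∀ s ∈ Ioo s₀ s₁, ∃ q ∈ U, e.symm '' ({s} ×ˢ Ioo t₀ t₁) ⊆ leaf G U q := by
  obtain ⟨δ₀, hδ₀, hU₀, T, hTc₀, hT1₀, hGT₀, hconst₀⟩ := hG.unit p hp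
  set a := (T p).1 with ha
  set b := (T p).2 with hb
  have hab : a ^ 2 + b ^ 2 = 1 := hT1₀ p (mem_ball_self hδ₀)
  have hTp : ContinuousAt T p := hTc₀.continuousAt (ball_mem_nhds p hδ₀)
  have hpos : ∀ᶠ q in 𝓝 p, 0 < (T q).1 * a + (T q).2 * b := by
    have hc : ContinuousAt (fun q => (T q).1 * a + (T q).2 * b) p :=
      (hTp.fst.mul continuousAt_const).add (hTp.snd.mul continuousAt_const)
    refine hc.eventually_const_lt ?_
    change 0 < a * a + b * b
    rw [← sq, ← sq, hab]
    exact one_pos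
  obtain ⟨δ, hδ, hball⟩ := Metric.eventually_nhds_iff_ball.1 (hpos.and (ball_mem_nhds p hδ₀))
  have hsub : ball p δ ⊆ ball p δ₀ := fun q hq => (hball q hq).2
  have hTc := hTc₀.mono hsub
  have hconst : ∀ q ∈ ball p δ, ∀ q' ∈ ball p δ,
      (q'.1 - q.1) * (T q).2 = (q'.2 - q.2) * (T q).1 → T q' = T q :=
    fun q hq q' hq' => hconst₀ q (hsub hq) q' (hsub hq')
  have hle : ∀ q ∈ ball p δ, |(T q).1| ≤ 1 ∧ |(T q).2| ≤ 1 := fun q hq => by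
    have := hT1₀ q (hsub hq)
    exact ⟨abs_le_of_sq_le_sq (by nlinarith [sq_nonneg (T q).2]) one_pos.le,
      abs_le_of_sq_le_sq (by nlinarith [sq_nonneg (T q).1]) one_pos.le⟩
  have hlep := hle p (mem_ball_self hδ)
  set η := δ / 4 with hη
  have hη0 : 0 < η := by positivity
  set R : Set (ℝ × ℝ) := Ioo (-η) η ×ˢ Ioo (-η) η with hR
  -- The transversal through p is orthogonal to T p, and Φ flows from it along straight lines. As T
  -- is constant on them, T q shows the way back from q to the transversal, so the inverse Ψ is
  -- explicit; `tt` is the time taken.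
  let base : ℝ → ℝ × ℝ := fun s => (p.1 - s * b, p.2 + s * a)
  let Φ : ℝ × ℝ → ℝ × ℝ := fun z => base z.1 + z.2 • T (base z.1)
  let tt : ℝ × ℝ → ℝ := fun q =>
    ((q.1 - p.1) * a + (q.2 - p.2) * b) / ((T q).1 * a + (T q).2 * b)
  let Ψ : ℝ × ℝ → ℝ × ℝ := fun q =>
    (-(q.1 - tt q * (T q).1 - p.1) * b + (q.2 - tt q * (T q).2 - p.2) * a, tt q)
  have hbase : ∀ s ∈ Ioo (-η) η, base s ∈ ball p δ := by
    intro s hs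
    have hs' := abs_lt.2 hs
    rw [mem_ball, Prod.dist_eq, Real.dist_eq, Real.dist_eq]
    have e1 : |(base s).1 - p.1| = |s| * |b| := by rw [← abs_mul, ← abs_neg]; congr 1; simp [base]
    have e2 : |(base s).2 - p.2| = |s| * |a| := by rw [← abs_mul]; congr 1; simp [base]
    refine max_lt ?_ ?_
    · rw [e1]; nlinarith [abs_nonneg s, hlep.2]
    · rw [e2]; nlinarith [abs_nonneg s, hlep.1]
  have hΦb : ∀ z ∈ R, Φ z ∈ ball p δ := by
    rintro ⟨s, t⟩ ⟨hs, ht⟩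
    simp only at hs ht
    have hs' := abs_lt.2 hs
    have ht' := abs_lt.2 ht
    have hT := hle _ (hbase s hs)
    rw [mem_ball, Prod.dist_eq, Real.dist_eq, Real.dist_eq]
    refine max_lt ?_ ?_
    · have e : (Φ (s, t)).1 - p.1 = -(s * b) + t * (T (base s)).1 := by simp [Φ, base]; ring
      rw [e]
      refine (abs_add_le _ _).trans_lt ?_
      rw [abs_neg, abs_mul, abs_mul]
      nlinarith [abs_nonneg s, abs_nonneg t, hlep.2, hT.1]
    · have e : (Φ (s, t)).2 - p.2 = s * a + t * (T (base s)).2 := by simp [Φ, base]; ring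
      rw [e]
      refine (abs_add_le _ _).trans_lt ?_
      rw [abs_mul, abs_mul]
      nlinarith [abs_nonneg s, abs_nonneg t, hlep.1, hT.2]
  have hTΦ : ∀ z ∈ R, T (Φ z) = T (base z.1) := by
    intro z hz
    refine hconst _ (hbase _ hz.1) _ (hΦb z hz) ?_
    simp only [Φ, Prod.fst_add, Prod.snd_add, Prod.smul_fst, Prod.smul_snd, smul_eq_mul]
    ring
  have hΨΦ : ∀ z ∈ R, Ψ (Φ z) = z := by
    rintro ⟨s, t⟩ hz
    have hT := hTΦ _ hz
    have hp0 := (hball _ (hbase s hz.1)).1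
    have ht : tt (Φ (s, t)) = t := by
      simp only [tt, hT]
      rw [div_eq_iff hp0.ne']
      simp only [Φ, base, Prod.fst_add, Prod.snd_add, Prod.smul_fst, Prod.smul_snd, smul_eq_mul]
      ring
    have : Ψ (Φ (s, t)) = (-((Φ (s, t)).1 - t * (T (base s)).1 - p.1) * b +
        ((Φ (s, t)).2 - t * (T (base s)).2 - p.2) * a, t) := by
      simp only [Ψ, ht, hT]
    rw [this]
    ext
    · simp only [Φ, base, Prod.fst_add, Prod.snd_add, Prod.smul_fst, Prod.smul_snd, smul_eq_mul]
      linear_combination s * hab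
    · rfl
  have hΦΨ : ∀ q ∈ ball p δ, Ψ q ∈ R → Φ (Ψ q) = q := by
    intro q hq hz
    have hne := (hball q hq).1.ne'
    have htt : tt q * ((T q).1 * a + (T q).2 * b) = (q.1 - p.1) * a + (q.2 - p.2) * b :=
      div_mul_cancel₀ _ hne
    have e1 : (base (Ψ q).1).1 = q.1 - tt q * (T q).1 := by
      simp only [base, Ψ]
      linear_combination a * htt + (q.1 - p.1 - tt q * (T q).1) * hab
    have e2 : (base (Ψ q).1).2 = q.2 - tt q * (T q).2 := by
      simp only [base, Ψ]
      linear_combination b * htt + (q.2 - p.2 - tt q * (T q).2) * hab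
    have hT : T (base (Ψ q).1) = T q := by
      refine hconst q hq _ (hbase _ hz.1) ?_
      rw [e1, e2]
      ring
    ext
    · simp only [Φ, Prod.fst_add, Prod.smul_fst, smul_eq_mul, hT, e1]
      simp only [Ψ]
      ring
    · simp only [Φ, Prod.snd_add, Prod.smul_snd, smul_eq_mul, hT, e2]
      simp only [Ψ]
      ring
  have hbasec : Continuous base := by fun_prop
  have hΦc : ContinuousOn Φ R := by
    refine ContinuousOn.add (by fun_prop) (continuousOn_snd.smul ?_)
    exact hTc.comp (by fun_prop) fun z hz => hbase _ hz.1
  have hΨc : ContinuousOn Ψ (ball p δ) := by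
    have h1 := hTc.fst
    have h2 := hTc.snd
    have htc : ContinuousOn tt (ball p δ) :=
      ContinuousOn.div (by fun_prop) (by fun_prop) fun q hq => (hball q hq).1.ne'
    fun_prop
  have hRo : IsOpen R := isOpen_Ioo.prod isOpen_Ioo
  have hΨp : Ψ p = (0, 0) := by simp [Ψ, tt]
  let e : OpenPartialHomeomorph (ℝ × ℝ) (ℝ × ℝ) :=
    { toFun := Ψ
      invFun := Φ
      source := ball p δ ∩ Ψ ⁻¹' R
      target := R
      map_source' := fun q hq => hq.2
      map_target' := fun z hz => ⟨hΦb z hz, by rw [mem_preimage, hΨΦ z hz]; exact hz⟩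
      left_inv' := fun q hq => hΦΨ q hq.1 hq.2
      right_inv' := hΨΦ
      open_source := hΨc.isOpen_inter_preimage isOpen_ball hRo
      open_target := hRo
      continuousOn_toFun := hΨc.mono inter_subset_left
      continuousOn_invFun := hΦc }
  refine ⟨e, ⟨mem_ball_self hδ, ?_⟩, fun q hq => hU₀ (hsub hq.1), -η, η, -η, η, rfl, ?_⟩
  · rw [mem_preimage, hΨp]
    exact ⟨⟨by simp [hη0], hη0⟩, ⟨by simp [hη0], hη0⟩⟩
  · intro s hs
    have hbs := hbase s hs
    have hfib : ({s} : Set ℝ) ×ˢ Ioo (-η) η ⊆ R := prod_mono (singleton_subset_iff.2 hs) subset_rfl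
    refine ⟨base s, hU₀ (hsub hbs), ?_⟩
    -- The image of a vertical fibre is a segment through `base s`, contained in U and in the line
    -- of that point.
    refine IsPreconnected.subset_connectedComponentIn
      ((isPreconnected_singleton.prod isPreconnected_Ioo).image _ (hΦc.mono hfib)) ?_ ?_
    · exact ⟨(s, 0), ⟨rfl, by simp [hη0]⟩, by change Φ (s, 0) = base s; simp [Φ]⟩
    · rintro _ ⟨⟨s', t⟩, ⟨hs', ht⟩, rfl⟩
      obtain rfl : s' = s := hs'
      refine ⟨?_, hU₀ (hsub (hΦb _ ⟨hs, ht⟩))⟩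
      rw [hGT₀ _ (hsub hbs), gLine_ratio (hT1₀ _ (hsub hbs))]
      change ((Φ (s', t)).1 - _) * _ = ((Φ (s', t)).2 - _) * _
      simp only [Φ, Prod.fst_add, Prod.snd_add, Prod.smul_fst, Prod.smul_snd, smul_eq_mul]
      ring

theorem isFoliationByLines (hG : IsLineField G U) :
    IsFoliationByLines U {L | ∃ p ∈ U, L = leaf G U p} where
  leaf_line := by
    rintro _ ⟨p, hp, rfl⟩
    exact ⟨gLine (G p) p, isLine_gLine _ _, p, ⟨self_mem_gLine _ _, hp⟩, rfl⟩
  exists_unique_leaf := by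
    intro p hp
    refine ⟨leaf G U p, ⟨⟨p, hp, rfl⟩, mem_leaf hp⟩, ?_⟩
    rintro _ ⟨⟨q, hq, rfl⟩, hpq⟩
    exact (hG.leaf_eq_of_mem hq hpq).symm
  chart := by
    intro p hp
    obtain ⟨e, h1, h2, s₀, s₁, t₀, t₁, h3, h4⟩ := hG.exists_chart hp
    refine ⟨e, h1, h2, s₀, s₁, t₀, t₁, h3, fun s hs => ?_⟩
    obtain ⟨q, hq, hqs⟩ := h4 s hs
    exact ⟨_, ⟨q, hq, rfl⟩, hqs⟩

end IsLineField

/-! ### Application to solutions of the equation -/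

/-- Along the regular points the two quotients have limits at every point, and these limits are
given by the local direction field. -/
theorem tendsto_ratio_regular {X Y : ℝ × ℝ → ℝ} {U : Set (ℝ × ℝ)} {p : ℝ × ℝ} {δ : ℝ}
    {T : ℝ × ℝ → ℝ × ℝ} (hTc : ContinuousOn T (ball p δ))
    (hT1 : ∀ q ∈ ball p δ, (T q).1 ^ 2 + (T q).2 ^ 2 = 1)
    (hTV : ∀ q ∈ ball p δ, X q ≠ 0 ∨ Y q ≠ 0 → (T q).1 * X q + (T q).2 * Y q = 0)
    {q : ℝ × ℝ} (hq : q ∈ ball p δ) :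
    Tendsto (fun z => ratio (Y z) (X z)) (𝓝[{z | z ∈ U ∧ (X z ≠ 0 ∨ Y z ≠ 0)}] q)
        (𝓝 (ratio (T q).1 (-(T q).2))) ∧
      Tendsto (fun z => ratio (X z) (Y z)) (𝓝[{z | z ∈ U ∧ (X z ≠ 0 ∨ Y z ≠ 0)}] q)
        (𝓝 (ratio (-(T q).2) (T q).1)) := by
  have hne : ∀ z ∈ ball p δ, (T z).1 ≠ 0 ∨ -(T z).2 ≠ 0 := by
    intro z hz
    by_contra! h
    have := hT1 z hz
    rw [h.1, neg_eq_zero.1 h.2] at this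
    norm_num at this
  have hTq := hTc.continuousAt (isOpen_ball.mem_nhds hq)
  have h1 := hTq.fst.tendsto.mono_left
    (nhdsWithin_le_nhds (s := {z | z ∈ U ∧ (X z ≠ 0 ∨ Y z ≠ 0)}))
  have h2 := hTq.snd.neg.tendsto.mono_left
    (nhdsWithin_le_nhds (s := {z | z ∈ U ∧ (X z ≠ 0 ∨ Y z ≠ 0)}))
  have hev : ∀ᶠ z in 𝓝[{z | z ∈ U ∧ (X z ≠ 0 ∨ Y z ≠ 0)}] q,
      z ∈ ball p δ ∧ (X z ≠ 0 ∨ Y z ≠ 0) := by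
    filter_upwards [self_mem_nhdsWithin, mem_nhdsWithin_of_mem_nhds (isOpen_ball.mem_nhds hq)]
      with z hz hzb using ⟨hzb, hz.2⟩
  refine ⟨(tendsto_ratio h1 h2 (hne q hq)).congr' ?_,
    (tendsto_ratio h2 h1 (hne q hq).symm).congr' ?_⟩
  · filter_upwards [hev] with z hz
    exact (ratio_eq_of_mul_eq (by linear_combination -hTV z hz.1 hz.2) (hne z hz.1) hz.2).symm
  · filter_upwards [hev] with z hz
    exact (ratio_eq_of_mul_eq (by linear_combination hTV z hz.1 hz.2) (hne z hz.1).symm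
      hz.2.symm).symm

theorem contDiffOn_fderiv_apply {f : ℝ × ℝ → ℝ} {U : Set (ℝ × ℝ)} (hU : IsOpen U)
    (hf : ContDiffOn ℝ 2 f U) (v : ℝ × ℝ) : ContDiffOn ℝ 1 (fun p => fderiv ℝ f p v) U :=
  (hf.fderiv_of_isOpen hU (by norm_num)).clm_apply contDiffOn_const

theorem fderiv_fderiv_apply {f : ℝ × ℝ → ℝ} {U : Set (ℝ × ℝ)} (hU : IsOpen U)
    (hf : ContDiffOn ℝ 2 f U) {p : ℝ × ℝ} (hp : p ∈ U) (v w : ℝ × ℝ) :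
    fderiv ℝ (fun p => fderiv ℝ f p v) p w = fderiv ℝ (fderiv ℝ f) p w v := by
  have h1 : DifferentiableAt ℝ (fderiv ℝ f) p :=
    ((hf.fderiv_of_isOpen hU (m := 1) (by norm_num)).differentiableOn one_ne_zero).differentiableAt
      (hU.mem_nhds hp)
  have h2 := (h1.hasFDerivAt.clm_apply (hasFDerivAt_const v p)).fderiv
  rw [h2]
  simp

theorem fderiv_dy_eq {f : ℝ × ℝ → ℝ} {U : Set (ℝ × ℝ)} (hU : IsOpen U)
    (hf : ContDiffOn ℝ 2 f U) {p : ℝ × ℝ} (hp : p ∈ U) :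
    fderiv ℝ (dy f) p (1, 0) = fderiv ℝ (dx f) p (0, 1) := by
  have hs := (hf.contDiffAt (hU.mem_nhds hp)).isSymmSndFDerivAt (by simp)
  have h1 := fderiv_fderiv_apply hU hf hp (0, 1) (1, 0)
  have h2 := fderiv_fderiv_apply hU hf hp (1, 0) (0, 1)
  exact h1.trans ((hs.eq _ _).trans h2.symm)

/-- A solution of the equation gives a vector field of divergence `2`. -/
theorem IsSolution.isField {f : ℝ × ℝ → ℝ} {U : Set (ℝ × ℝ)} (hf : IsSolution f U)
    (hU : IsOpen U) : IsField (P f) (Q f) U := by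
  have cx : ContDiffOn ℝ 1 (dx f) U := contDiffOn_fderiv_apply hU hf.1 (1, 0)
  have cy : ContDiffOn ℝ 1 (dy f) U := contDiffOn_fderiv_apply hU hf.1 (0, 1)
  have dX : ∀ p ∈ U, ∀ v, fderiv ℝ (P f) p v = v.1 - 2 * fderiv ℝ (dy f) p v := by
    intro p hp v
    have h := ((cy.differentiableOn one_ne_zero).differentiableAt (hU.mem_nhds hp)).hasFDerivAt
    have h2 : HasFDerivAt (P f) _ p := hasFDerivAt_fst.sub (h.const_mul 2)
    rw [h2.fderiv]
    simp
  have dY : ∀ p ∈ U, ∀ v, fderiv ℝ (Q f) p v = v.2 + 2 * fderiv ℝ (dx f) p v := by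
    intro p hp v
    have h := ((cx.differentiableOn one_ne_zero).differentiableAt (hU.mem_nhds hp)).hasFDerivAt
    have h2 : HasFDerivAt (Q f) _ p := hasFDerivAt_snd.add (h.const_mul 2)
    rw [h2.fderiv]
    simp
  refine ⟨hU, contDiffOn_fst.sub (contDiffOn_const.mul cy), contDiffOn_snd.add
    (contDiffOn_const.mul cx), fun p hp => ?_, fun p hp => ?_⟩
  · rw [dX p hp, dY p hp, fderiv_dy_eq hU hf.1 hp]
    ring
  · rw [dX p hp, dX p hp, dY p hp, dY p hp, fderiv_dy_eq hU hf.1 hp]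
    have h := hf.2 p hp
    simp only [P, Q]
    have e1 : dy (dy f) p = fderiv ℝ (dy f) p (0, 1) := rfl
    have e2 : dx (dx f) p = fderiv ℝ (dx f) p (1, 0) := rfl
    have e3 : dy (dx f) p = fderiv ℝ (dx f) p (0, 1) := rfl
    rw [e1, e2, e3] at h
    linear_combination h

theorem ratio_swap_of_eq {a b a' b' : ℝ} (hab : a ≠ 0 ∨ b ≠ 0) (hab' : a' ≠ 0 ∨ b' ≠ 0)
    (h : ratio a b = ratio a' b') : ratio b a = ratio b' a' := by
  refine ratio_eq_of_mul_eq ?_ hab'.symm hab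
  by_cases hb : b = 0 <;> by_cases hb' : b' = 0
  · simp [hb, hb']
  · simp [ratio, hb, hb'] at h
  · simp [ratio, hb, hb'] at h
  · rw [ratio, ratio, if_neg hb, if_neg hb', OnePoint.coe_eq_coe, div_eq_div_iff hb hb'] at h
    linear_combination -h

theorem IsSolution.exists_foliation {f : ℝ × ℝ → ℝ} {U : Set (ℝ × ℝ)} (hf : IsSolution f U)
    (hU : IsOpen U) :
    U ⊆ closure {p | p ∈ U ∧ IsRegular f p} ∧
    ∃ G H : ℝ × ℝ → OnePoint ℝ,
      IsContinuousExtension f U (g f) G ∧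
      IsContinuousExtension f U (h f) H ∧
      ∃ F : Set (Set (ℝ × ℝ)), IsFoliationByLines U F ∧
        (∀ L ∈ F, ∀ p ∈ L, ∀ q ∈ L, G p = G q) ∧
        (∀ L ∈ F, ∀ p ∈ L, ∀ q ∈ L, H p = H q) ∧
        (∀ p ∈ U, connectedComponentIn (gLine (G p) p ∩ U) p ∈ F) ∧
        (∀ p ∈ U, connectedComponentIn (hLine (H p) p ∩ U) p ∈ F) := by
  have hF := hf.isField hU
  have hcl : U ⊆ closure {p | p ∈ U ∧ IsRegular f p} := fun p hp => hF.mem_closure_regular hp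
  set R := {p | p ∈ U ∧ IsRegular f p} with hR
  set G := extendFrom R (g f) with hG
  set H := extendFrom R (h f) with hH
  have hloc : ∀ p ∈ U, ∃ δ > 0, ball p δ ⊆ U ∧ ∃ T : ℝ × ℝ → ℝ × ℝ, ContinuousOn T (ball p δ) ∧
      (∀ q ∈ ball p δ, (T q).1 ^ 2 + (T q).2 ^ 2 = 1) ∧
      (∀ q ∈ ball p δ, Tendsto (g f) (𝓝[R] q) (𝓝 (ratio (T q).1 (-(T q).2))) ∧
        Tendsto (h f) (𝓝[R] q) (𝓝 (ratio (-(T q).2) (T q).1))) ∧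
      ∀ q ∈ ball p δ, ∀ q' ∈ ball p δ,
        (q'.1 - q.1) * (T q).2 = (q'.2 - q.2) * (T q).1 → T q' = T q := by
    intro p hp
    obtain ⟨δ, hδ, hb, T, hTc, hT1, hTV, hconst⟩ := hF.exists_local_direction hp
    exact ⟨δ, hδ, hb, T, hTc, hT1, fun q hq => tendsto_ratio_regular hTc hT1 hTV hq, hconst⟩
  have htend : ∀ p ∈ U, ∃ t : ℝ × ℝ, t.1 ^ 2 + t.2 ^ 2 = 1 ∧
      Tendsto (g f) (𝓝[R] p) (𝓝 (ratio t.1 (-t.2))) ∧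
      Tendsto (h f) (𝓝[R] p) (𝓝 (ratio (-t.2) t.1)) := by
    intro p hp
    obtain ⟨δ, hδ, -, T, -, hT1, hTR, -⟩ := hloc p hp
    exact ⟨T p, hT1 p (mem_ball_self hδ), hTR p (mem_ball_self hδ)⟩
  have hreg : ∀ p ∈ U, IsRegular f p → G p = g f p ∧ H p = h f p := by
    intro p hp hr
    have h1 := (hF.hasFDerivAt_fst hp).continuousAt.tendsto.mono_left (nhdsWithin_le_nhds (s := R))
    have h2 := (hF.hasFDerivAt_snd hp).continuousAt.tendsto.mono_left (nhdsWithin_le_nhds (s := R))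
    exact ⟨extendFrom_eq (hcl hp) (tendsto_ratio h2 h1 (Or.symm hr)),
      extendFrom_eq (hcl hp) (tendsto_ratio h1 h2 hr)⟩
  have hval : ∀ p ∈ U, ∃ t : ℝ × ℝ, t.1 ^ 2 + t.2 ^ 2 = 1 ∧ G p = ratio t.1 (-t.2) ∧
      H p = ratio (-t.2) t.1 := by
    intro p hp
    obtain ⟨t, ht, h1, h2⟩ := htend p hp
    exact ⟨t, ht, extendFrom_eq (hcl hp) h1, extendFrom_eq (hcl hp) h2⟩
  have hGc : ContinuousOn G U := continuousOn_extendFrom hcl fun p hp => by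
    obtain ⟨t, -, h1, -⟩ := htend p hp
    exact ⟨_, h1⟩
  have hHc : ContinuousOn H U := continuousOn_extendFrom hcl fun p hp => by
    obtain ⟨t, -, -, h2⟩ := htend p hp
    exact ⟨_, h2⟩
  have hL : IsLineField G U := by
    refine ⟨hGc, fun p hp => ?_⟩
    obtain ⟨δ, hδ, hb, T, hTc, hT1, hTR, hconst⟩ := hloc p hp
    exact ⟨δ, hδ, hb, T, hTc, hT1, fun q hq => extendFrom_eq (hcl (hb hq)) (hTR q hq).1, hconst⟩
  -- H is the reciprocal of G in ℝ ∪ {∞}, so constancy of G on a leaf gives constancy of H.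
  have hHG : ∀ p ∈ U, ∀ q ∈ U, G p = G q → H p = H q := by
    have hne : ∀ t : ℝ × ℝ, t.1 ^ 2 + t.2 ^ 2 = 1 → t.1 ≠ 0 ∨ -t.2 ≠ 0 := by
      intro t ht
      by_contra! hcon
      rw [hcon.1, neg_eq_zero.1 hcon.2] at ht
      norm_num at ht
    intro p hp q hq hpq
    obtain ⟨t, ht, e1, e2⟩ := hval p hp
    obtain ⟨t', ht', e1', e2'⟩ := hval q hq
    rw [e2, e2']
    exact ratio_swap_of_eq (hne t ht) (hne t' ht') (by rw [← e1, ← e1', hpq])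
  have hGF : ∀ L ∈ {L | ∃ p ∈ U, L = leaf G U p}, ∀ p ∈ L, ∀ q ∈ L, G p = G q := by
    rintro _ ⟨z, hz, rfl⟩ p hp q hq
    rw [hL.eq_of_mem_leaf hz hp, hL.eq_of_mem_leaf hz hq]
  refine ⟨hcl, G, H, ⟨hGc, fun p hp hr => (hreg p hp hr).1⟩, ⟨hHc, fun p hp hr => (hreg p hp hr).2⟩,
    {L | ∃ p ∈ U, L = leaf G U p}, hL.isFoliationByLines, hGF, ?_, fun p hp => ⟨p, hp, rfl⟩, ?_⟩
  · intro L hLF p hp q hq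
    have hsub : L ⊆ U := by
      obtain ⟨z, -, rfl⟩ := hLF
      exact fun w hw => (IsLineField.leaf_subset z hw).2
    exact hHG p (hsub hp) q (hsub hq) (hGF L hLF p hp q hq)
  · intro p hp
    obtain ⟨t, ht, e1, e2⟩ := hval p hp
    refine ⟨p, hp, ?_⟩
    rw [leaf, e1, e2, gLine_ratio ht, hLine_ratio ht]

end ZeroCOT

theorem mainTheorem2 (U : Set (ℝ × ℝ)) (hU : IsOpen U) (f : ℝ × ℝ → ℝ)
    (hf : ZeroCOT.IsSolution f U) :
    U ⊆ closure {p | p ∈ U ∧ ZeroCOT.IsRegular f p} ∧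
    ∃ G H : ℝ × ℝ → OnePoint ℝ,
      ZeroCOT.IsContinuousExtension f U (ZeroCOT.g f) G ∧
      ZeroCOT.IsContinuousExtension f U (ZeroCOT.h f) H ∧
      ∃ F : Set (Set (ℝ × ℝ)), ZeroCOT.IsFoliationByLines U F ∧
        (∀ L ∈ F, ∀ p ∈ L, ∀ q ∈ L, G p = G q) ∧
        (∀ L ∈ F, ∀ p ∈ L, ∀ q ∈ L, H p = H q) ∧
        (∀ p ∈ U, connectedComponentIn (ZeroCOT.gLine (G p) p ∩ U) p ∈ F) ∧
        (∀ p ∈ U, connectedComponentIn (ZeroCOT.hLine (H p) p ∩ U) p ∈ F) :=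
  hf.exists_foliation hU
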